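/- **Conventions.** A machine has a one-way read-only input tape containing a finite bit string, an auxiliary tape containing a finite sequence of encoded objects, and a write-only output tape on which it writes a finite or infinite sequence of encoded objects. Write $U_z(p)=x$ if the machine $U$, with $z$ on the auxiliary tape, halts on input $p\in\{0,1\}^*$ after reading exactly the $\|p\|$ bits of $p$, with output $x$. Let $U$ be a universal machine, that is, for every machine $M$ there is a string $r$ such that, for all $z$ and $p$, $U$ with auxiliary data $z$ on input $rp$ behaves as $M$ with auxiliary data $z$ on input $p$ (same output sequence, same halting, same part of the input left unread). Put $\mathbf m(x/z)=\sum\{2^{-\|p\|}: U_z(p)=x\}$. Vectors and matrices are elementary if their entries have rational real and imaginary parts; a semi-density matrix is a positive semidefinite matrix of trace at most $1$; $\leq$ is the Loewner order. Let $\mathcal Q_n=(\mathbb C^2)^{\otimes n}$, with $n\ge 0$, be the space of $n$ qubits and let $A$ be an elementary unitary $2^n\times 2^n$ matrix. Everything is relativized to $A$, i.e. an encoding of $A$ is always provided to $U$ on the auxiliary tape. * Let $\boldsymbol\mu=\sum_{\varphi}\mathbf m(\varphi/A,n)\,|\varphi\rangle\langle\varphi|$, the sum over all elementary unit vectors $|\varphi\rangle\in\mathcal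 Q_n$. * A program $q\in\{0,1\}^*$ lower computes a positive semidefinite matrix $\nu$ if $U$, on input $q$ and with $A$ on the auxiliary tape, never attempts to read more than the $\|q\|$ bits of $q$ and outputs, with or without halting, a nonempty finite or infinite sequence $\nu_1\leq\nu_2\leq\cdots$ of elementary positive semidefinite matrices with limit $\nu$ (the last term, if the sequence is finite). The matrix $\nu$ is lower computable if some program lower computes it, and $\underline{\mathbf m}(\nu/A,n)=\sum\{\mathbf m(q/A,n): q\text{ lower computes }\nu\}$. * Let $\mathcal C$ be the set of all lower computable matrices on $\mathcal Q_n\otimes\mathcal Q_n$ of the form $E\otimes F$ with $\operatorname{Tr}(E\otimes F)(\boldsymbol\mu\otimes\boldsymbol\mu)\le 1$, and let $\mathfrak C=\sum_{\nu\in\mathcal C}\underline{\mathbf m}(\nu/A,n)\,\nu$. * For semi-density matrices $\sigma,\rho$ on $\mathcal Q_n$ let $\mathbf I(\sigma:\rho)=\log_2\operatorname{Tr}\,\mathfrak C(\sigma\otimes\rho)$, with $\log_2 0=-\infty$. **Theorem (Conservation of Information, Unitary Transform).** The series defining $\boldsymbol\mu$ and $\mathfrak C$ converge (this also holds when $A$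 is replaced by arbitrary auxiliary data), and there is a constant $c\in\mathbb R$, depending only on $U$, such that for all $n$, all elementary unitary $2^n\times 2^n$ matrices $A$ and all semi-density matrices $\sigma,\rho$ on $\mathcal Q_n$, relativized to $A$, $$\mathbf I(\sigma:\rho)-c\;\le\;\mathbf I(A\sigma A^*:\rho)\;\le\;\mathbf I(\sigma:\rho)+c .$$ -/

import Mathlib

open scoped ENNReal Topology ComplexOrder

noncomputable section

/-! ### Machines with a one-way input tape, auxiliary data and a write-only output tape -/

/-- One atomic action of a machine; `s`, `s₀`, `s₁` are the successor states. -/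
inductive MachineAction where
  /-- internal computation -/
  | compute (s : ℕ)
  /-- read the next bit of the input tape, go to `s₀` on `0` and to `s₁` on `1` -/
  | read (s₀ s₁ : ℕ)
  /-- write the item `x` on the output tape -/
  | write (x s : ℕ)
  | halt

namespace MachineAction

/-- Actions as a sum type (this supplies the encoding of actions by natural numbers). -/
def equivSum : MachineAction ≃ (ℕ ⊕ ℕ × ℕ) ⊕ Option (ℕ × ℕ) where
  toFun
    | compute s => .inl (.inl s)
    | read s₀ s₁ => .inl (.inr (s₀, s₁))
    | write x s => .inr (some (x, s))
    | halt => .inr none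
  invFun
    | .inl (.inl s) => compute s
    | .inl (.inr (s₀, s₁)) => read s₀ s₁
    | .inr (some (x, s)) => write x s
    | .inr none => halt
  left_inv a := by cases a <;> rfl
  right_inv a := by rcases a with (_ | ⟨_, _⟩) | (_ | ⟨_, _⟩) <;> rfl

instance : Primcodable MachineAction := Primcodable.ofEquiv _ equivSum

end MachineAction

/-- A machine: states (the contents of the work tapes, the head positions and the control state)
are coded by natural numbers, the initial state is `0`, and the next action is a computable
function of the auxiliary data (a finite sequence of natural numbers on the auxiliary tape) and of
the state. The bits of the input tape can be accessed only by `MachineAction.read`, one after the other. -/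
structure Machine where
  step : List ℕ → ℕ → MachineAction
  computable_step : Computable₂ step

/-- State, unread part of the input, and sequence of the items written so far. -/
structure Config where
  state : ℕ
  input : List Bool
  output : List ℕ

namespace Machine

/-- One step. A machine that has halted, or that wants to read beyond the end of the input,
stays where it is. -/
def next (U : Machine) (z : List ℕ) (C : Config) : Config :=
  match U.step z C.state with
  | .compute s => ⟨s, C.input, C.output⟩
  | .read s₀ s₁ =>
    match C.input with
    | [] => C
    | b :: l => ⟨bif b then s₁ else s₀, l, C.output⟩
  | .write x s => ⟨s, C.input, C.output ++ [x]⟩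
  | .halt => C

/-- The configuration after `t` steps with auxiliary data `z` on the input `p`. -/
def conf (U : Machine) (z : List ℕ) (p : List Bool) (t : ℕ) : Config :=
  (U.next z)^[t] ⟨0, p, []⟩

def Halted (U : Machine) (z : List ℕ) (C : Config) : Prop :=
  U.step z C.state = .halt

/-- The machine is about to read beyond the end of the input. -/
def Overrun (U : Machine) (z : List ℕ) (C : Config) : Prop :=
  C.input = [] ∧ ∃ s₀ s₁, U.step z C.state = .read s₀ s₁

/-- `U_z(p) = x`: with auxiliary data `z` the machine halts after reading exactly the bits of `p`,
and its output is `x`. -/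
def Outputs (U : Machine) (z : List ℕ) (p : List Bool) (x : ℕ) : Prop :=
  ∃ t, U.Halted z (U.conf z p t) ∧ (U.conf z p t).input = [] ∧ (U.conf z p t).output = [x]

/-- On input `p` the machine `U` behaves as the machine `M` on input `q`, up to the time it takes:
it writes the same (finite or infinite) sequence, it halts iff `M` does, leaving the same part of
the input unread, and it reads beyond the end of the input iff `M` does. -/
def BehavesAs (U M : Machine) (z : List ℕ) (p q : List Bool) : Prop :=
  (∀ o, (∃ t, (U.conf z p t).output = o) ↔ ∃ t, (M.conf z q t).output = o) ∧
  (∀ i, (∃ t, U.Halted z (U.conf z p t) ∧ (U.conf z p t).input = i) ↔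
    ∃ t, M.Halted z (M.conf z q t) ∧ (M.conf z q t).input = i) ∧
  ((∃ t, U.Overrun z (U.conf z p t)) ↔ ∃ t, M.Overrun z (M.conf z q t))

/-- `U` is universal: every machine is simulated by `U` with the help of a fixed prefix. -/
def Universal (U : Machine) : Prop :=
  ∀ M : Machine, ∃ r : List Bool, ∀ (z : List ℕ) (p : List Bool), U.BehavesAs M z (r ++ p) p

/-- The universal probability `𝐦(x/z) = ∑ 2^(-‖p‖)`, the sum over all `p` with `U_z(p) = x`.
(For fixed `z` the halting programs are prefix-free, so the value is at most `1`.) -/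
def prob (U : Machine) (x : ℕ) (z : List ℕ) : ℝ≥0∞ :=
  ∑' p : {p : List Bool // U.Outputs z p x}, (2 : ℝ≥0∞)⁻¹ ^ p.1.length

end Machine

/-! ### Elementary objects -/

/-- The complex number with rational real and imaginary part. -/
def toComplex (a : ℚ × ℚ) : ℂ := ⟨a.1, a.2⟩

/-- An elementary `d × d` matrix, given by its entries. -/
abbrev EMatrix (d : ℕ) := Matrix (Fin d) (Fin d) (ℚ × ℚ)

/-- The complex matrix denoted by an elementary matrix. -/
def EMatrix.val {d : ℕ} (M : EMatrix d) : Matrix (Fin d) (Fin d) ℂ := M.map toComplex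

/-- Numerators and denominators of the real and imaginary part, in lowest terms. -/
def fractions (a : ℚ × ℚ) : (ℤ × ℕ) × (ℤ × ℕ) := ((a.1.num, a.1.den), (a.2.num, a.2.den))

/-- The natural number that encodes an elementary vector. -/
def vecCode {d : ℕ} (v : Fin d → ℚ × ℚ) : ℕ :=
  Encodable.encode (List.ofFn fun i => fractions (v i))

/-- The natural number that encodes an elementary matrix. -/
def matCode {d : ℕ} (M : EMatrix d) : ℕ :=
  Encodable.encode (List.ofFn fun i => List.ofFn fun j => fractions (M i j))

/-- Elementary pure states of `n` qubits. -/
def EState (n : ℕ) := {v : Fin (2 ^ n) → ℚ × ℚ // ∑ i, ‖toComplex (v i)‖ ^ 2 = 1}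

/-- `|φ⟩⟨φ|` -/
def EState.proj {n : ℕ} (φ : EState n) : Matrix (Fin (2 ^ n)) (Fin (2 ^ n)) ℂ :=
  Matrix.of fun i j => toComplex (φ.1 i) * star (toComplex (φ.1 j))

/-- A semi-density matrix is positive semidefinite of trace at most `1`. -/
def IsSemiDensity {d : ℕ} (σ : Matrix (Fin d) (Fin d) ℂ) : Prop :=
  σ.PosSemidef ∧ σ.trace.re ≤ 1

/-- The tensor product (Kronecker product) of two `d × d` matrices, as a `d² × d²` matrix. -/
def tensor {d : ℕ} (M N : Matrix (Fin d) (Fin d) ℂ) : Matrix (Fin (d * d)) (Fin (d * d)) ℂ :=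
  Matrix.reindex finProdFinEquiv finProdFinEquiv (Matrix.kroneckerMap (· * ·) M N)

/-! ### Universal matrix, lower algorithmic probability, mutual information -/

namespace Machine

/-- The term of the universal matrix that belongs to the elementary state `φ`. -/
def universalTerm (U : Machine) (z : List ℕ) (n : ℕ) (φ : EState n) :
    Matrix (Fin (2 ^ n)) (Fin (2 ^ n)) ℂ :=
  (U.prob (vecCode φ.1) (z ++ [n])).toReal • φ.proj

/-- The universal matrix `𝛍` over `n` qubits, relativized to `z`:
`𝛍 = ∑ 𝐦(φ/z,n) |φ⟩⟨φ|`, the sum over all elementary pure states `φ` of `n` qubits. -/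
def universalMatrix (U : Machine) (z : List ℕ) (n : ℕ) : Matrix (Fin (2 ^ n)) (Fin (2 ^ n)) ℂ :=
  ∑' φ : EState n, U.universalTerm z n φ

/-- The program `q` lower computes the matrix `σ`, relative to `z`: on input `q` and with auxiliary
data `z`, the machine never reads more than the bits of `q` and it writes, with or without halting,
a nonempty finite or infinite sequence of elementary positive semidefinite matrices that is
increasing in the Loewner order and whose limit is `σ`. Here `L t` is the sequence of the matrices
written in the first `t` steps. -/
def LowerComputes (U : Machine) (z : List ℕ) (q : List Bool) {d : ℕ}
    (σ : Matrix (Fin d) (Fin d) ℂ) : Prop :=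
  (∀ t, ¬ U.Overrun z (U.conf z q t)) ∧
  ∃ L : ℕ → List (EMatrix d),
    (∀ t, (U.conf z q t).output = (L t).map matCode) ∧
    (∀ t, ∀ M ∈ L t, M.val.PosSemidef) ∧
    (∀ t, (L t).Pairwise fun M N => (N.val - M.val).PosSemidef) ∧
    (∃ t, L t ≠ []) ∧
    Filter.Tendsto (fun t => (L t).getLast?.elim 0 EMatrix.val) Filter.atTop (𝓝 σ)

def LowerComputable (U : Machine) (z : List ℕ) {d : ℕ} (σ : Matrix (Fin d) (Fin d) ℂ) : Prop :=
  ∃ q, U.LowerComputes z q σ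

/-- The lower algorithmic probability `∑ 𝐦(q/z,n)` of the matrix `ν`, the sum over all programs `q`
that lower compute `ν` relative to `z`. -/
def lowerProb (U : Machine) (z : List ℕ) (n : ℕ) {d : ℕ} (ν : Matrix (Fin d) (Fin d) ℂ) : ℝ≥0∞ :=
  ∑' q : {q : List Bool // U.LowerComputes z q ν}, U.prob (Encodable.encode q.1) (z ++ [n])

/-- The set of all lower computable matrices of the form `E ⊗ F` with `Tr (E ⊗ F)(C ⊗ D) ≤ 1`. -/
def productTests (U : Machine) (z : List ℕ) {d : ℕ} (C D : Matrix (Fin d) (Fin d) ℂ) :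
    Set (Matrix (Fin (d * d)) (Fin (d * d)) ℂ) :=
  {ν | (∃ E F : Matrix (Fin d) (Fin d) ℂ, ν = tensor E F) ∧ U.LowerComputable z ν ∧
    (ν * tensor C D).trace.re ≤ 1}

/-- The term of the aggregated test that belongs to the test `ν`. -/
def testTerm (U : Machine) (z : List ℕ) (n : ℕ) (C D : Matrix (Fin (2 ^ n)) (Fin (2 ^ n)) ℂ)
    (ν : U.productTests z C D) : Matrix (Fin (2 ^ n * 2 ^ n)) (Fin (2 ^ n * 2 ^ n)) ℂ :=
  (U.lowerProb z n ν.1).toReal • ν.1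

/-- The aggregation of all product tests, weighted by their lower algorithmic probabilities. -/
def aggregatedTest (U : Machine) (z : List ℕ) (n : ℕ)
    (C D : Matrix (Fin (2 ^ n)) (Fin (2 ^ n)) ℂ) :
    Matrix (Fin (2 ^ n * 2 ^ n)) (Fin (2 ^ n * 2 ^ n)) ℂ :=
  ∑' ν : U.productTests z C D, U.testTerm z n C D ν

/-- The mutual information `𝐈(σ : ρ) = log₂ Tr 𝕮 (σ ⊗ ρ)`, relativized to `z`, where `𝕮` is the
aggregated test for `𝛍 ⊗ 𝛍`. It is `-∞` where the trace vanishes. -/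
def mutualInfo (U : Machine) (z : List ℕ) (n : ℕ) (σ ρ : Matrix (Fin (2 ^ n)) (Fin (2 ^ n)) ℂ) :
    EReal :=
  ENNReal.log (ENNReal.ofReal
    (U.aggregatedTest z n (U.universalMatrix z n) (U.universalMatrix z n) * tensor σ ρ).trace.re)
    / (Real.log 2 : ℝ)

end Machine

/-! ### There is a universal machine -/

namespace Machine

open Encodable
open Nat.Partrec (Code)

/-- States of the universal machine: the number of zeros read so far, or a code of the step
function of the simulated machine, its state, and the number of steps spent on evaluating it. -/
abbrev UState := ℕ ⊕ (ℕ × ℕ × ℕ)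

/-- Performs the action of the simulated machine with code `c`. -/
def lift (c : ℕ) (a : MachineAction) : MachineAction :=
  let g : ℕ → ℕ := fun s => encode (Sum.inr (c, s, 0) : UState)
  MachineAction.equivSum.symm
    ((MachineAction.equivSum a).elim
      (fun b => .inl (b.elim (fun s => .inl (g s)) (fun x => .inr (g x.1, g x.2))))
      (fun o => .inr (o.map fun x => (x.1, g x.2))))

/-- The action of the universal machine. -/
def ustep (z : List ℕ) (s : ℕ) : MachineAction :=
  (Denumerable.ofNat UState s).elim
    (fun k => MachineAction.equivSum.symm (.inl (.inr
      (encode (Sum.inl (k + 1) : UState), encode (Sum.inr (k, 0, 0) : UState)))))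
    (fun x => ((Code.evaln x.2.2 (Denumerable.ofNat Code x.1) (encode (z, x.2.1))).bind
      (fun v => (decode v : Option MachineAction))).elim
        (MachineAction.equivSum.symm (.inl (.inl
          (encode (Sum.inr (x.1, x.2.1, x.2.2 + 1) : UState)))))
        (lift x.1))

theorem primrec_lift : Primrec₂ lift := by
  have he : Primrec MachineAction.equivSum := Primrec.of_equiv
  have hs : Primrec MachineAction.equivSum.symm := Primrec.of_equiv_symm
  have hg : Primrec₂ fun c s : ℕ => encode (Sum.inr (c, s, 0) : UState) :=
    Primrec.encode.comp (Primrec.sumInr.comp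
      (Primrec.fst.pair (Primrec.snd.pair (Primrec.const 0))))
  refine hs.comp (Primrec.sumCasesOn (he.comp Primrec.snd) ?_ ?_)
  · refine Primrec.sumInl.comp (Primrec.sumCasesOn Primrec.snd ?_ ?_)
    · exact Primrec.sumInl.comp (hg.comp (Primrec.fst.comp (Primrec.fst.comp Primrec.fst))
        Primrec.snd)
    · exact Primrec.sumInr.comp ((hg.comp (Primrec.fst.comp (Primrec.fst.comp Primrec.fst))
        (Primrec.fst.comp Primrec.snd)).pair (hg.comp (Primrec.fst.comp
          (Primrec.fst.comp Primrec.fst)) (Primrec.snd.comp Primrec.snd)))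
  · refine Primrec.sumInr.comp (Primrec.option_map Primrec.snd ?_)
    exact (Primrec.fst.comp Primrec.snd).pair (hg.comp (Primrec.fst.comp
      (Primrec.fst.comp Primrec.fst)) (Primrec.snd.comp Primrec.snd))

theorem primrec_ustep : Primrec₂ ustep := by
  have hs : Primrec MachineAction.equivSum.symm := Primrec.of_equiv_symm
  refine Primrec.sumCasesOn ((Primrec.ofNat UState).comp Primrec.snd) ?_ ?_
  · have h₁ : Primrec fun p : (List ℕ × ℕ) × ℕ => encode (Sum.inl (p.2 + 1) : UState) :=
      Primrec.encode.comp (Primrec.sumInl.comp (Primrec.succ.comp Primrec.snd))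
    have h₂ : Primrec fun p : (List ℕ × ℕ) × ℕ => encode (Sum.inr (p.2, 0, 0) : UState) :=
      Primrec.encode.comp (Primrec.sumInr.comp (Primrec.snd.pair (Primrec.const (0, 0))))
    exact (hs.comp (Primrec.sumInl.comp (Primrec.sumInr.comp (h₁.pair h₂)))).to₂
  · have hc : Primrec fun p : (List ℕ × ℕ) × ℕ × ℕ × ℕ => p.2.1 := Primrec.fst.comp Primrec.snd
    have hst : Primrec fun p : (List ℕ × ℕ) × ℕ × ℕ × ℕ => p.2.2.1 :=
      Primrec.fst.comp (Primrec.snd.comp Primrec.snd)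
    have hf : Primrec fun p : (List ℕ × ℕ) × ℕ × ℕ × ℕ => p.2.2.2 :=
      Primrec.snd.comp (Primrec.snd.comp Primrec.snd)
    have hz : Primrec fun p : (List ℕ × ℕ) × ℕ × ℕ × ℕ => p.1.1 := Primrec.fst.comp Primrec.fst
    have hev := Code.primrec_evaln.comp ((hf.pair ((Primrec.ofNat Code).comp hc)).pair
      (Primrec.encode.comp (hz.pair hst)))
    have hn : Primrec fun p : (List ℕ × ℕ) × ℕ × ℕ × ℕ =>
        encode (Sum.inr (p.2.1, p.2.2.1, p.2.2.2 + 1) : UState) :=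
      Primrec.encode.comp (Primrec.sumInr.comp (hc.pair (hst.pair (Primrec.succ.comp hf))))
    have := Primrec.option_casesOn (Primrec.option_bind hev
        ((Primrec.decode (α := MachineAction)).comp Primrec.snd).to₂)
      (hs.comp (Primrec.sumInl.comp (Primrec.sumInl.comp hn)))
      (primrec_lift.comp (hc.comp Primrec.fst) Primrec.snd).to₂
    refine this.of_eq ?_
    rintro ⟨⟨z, s⟩, c, s', f⟩
    dsimp only
    cases (Code.evaln f (Denumerable.ofNat Code c) (encode (z, s'))).bind
      (fun v => (decode v : Option MachineAction)) <;> rfl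

/-- A universal machine. -/
def universalMachine : Machine := ⟨ustep, primrec_ustep.to_comp⟩

theorem conf_succ (U : Machine) (z : List ℕ) (p : List Bool) (t : ℕ) :
    U.conf z p (t + 1) = U.next z (U.conf z p t) :=
  Function.iterate_succ_apply' _ _ _

/-- The configuration of the universal machine that corresponds to `C`. -/
def embed (k f : ℕ) (C : Config) : Config :=
  ⟨encode (Sum.inr (k, C.state, f) : UState), C.input, C.output⟩

theorem exists_code (M : Machine) : ∃ k, ∀ z s,
    (∃ f, (Code.evaln f (Denumerable.ofNat Code k) (encode (z, s))).bind
      (fun v => (decode v : Option MachineAction)) = some (M.step z s)) ∧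
    ∀ f, (Code.evaln f (Denumerable.ofNat Code k) (encode (z, s))).bind
      (fun v => (decode v : Option MachineAction)) = none ∨
      (Code.evaln f (Denumerable.ofNat Code k) (encode (z, s))).bind
      (fun v => (decode v : Option MachineAction)) = some (M.step z s) := by
  obtain ⟨c, hc⟩ := Code.exists_code.1 M.computable_step
  have key : ∀ z s, Code.eval c (encode (z, s)) = Part.some (encode (M.step z s)) := by
    intro z s
    rw [hc]
    simp
  refine ⟨encode c, fun z s => ?_⟩
  rw [Denumerable.ofNat_encode]
  constructor
  · have : encode (M.step z s) ∈ Code.eval c (encode (z, s)) := by rw [key]; exact Part.mem_some _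
    obtain ⟨f, hf⟩ := Code.evaln_complete.1 this
    refine ⟨f, ?_⟩
    rw [Option.mem_def.1 hf]
    simp
  · intro f
    cases h : Code.evaln f c (encode (z, s)) with
    | none => left; rfl
    | some v =>
      right
      have := Code.evaln_sound (Option.mem_def.2 h)
      rw [key, Part.mem_some_iff] at this
      simp [this]

theorem ustep_inl (z : List ℕ) (k : ℕ) : ustep z (encode (Sum.inl k : UState)) =
    .read (encode (Sum.inl (k + 1) : UState)) (encode (Sum.inr (k, 0, 0) : UState)) := by
  simp only [ustep, Denumerable.ofNat_encode]
  rfl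

theorem ustep_none {z : List ℕ} {k s f : ℕ}
    (h : (Code.evaln f (Denumerable.ofNat Code k) (encode (z, s))).bind
      (fun v => (decode v : Option MachineAction)) = none) :
    ustep z (encode (Sum.inr (k, s, f) : UState)) =
      .compute (encode (Sum.inr (k, s, f + 1) : UState)) := by
  simp only [ustep, Denumerable.ofNat_encode, Sum.elim_inr, h]
  rfl

theorem ustep_some {z : List ℕ} {k s f : ℕ} {a : MachineAction}
    (h : (Code.evaln f (Denumerable.ofNat Code k) (encode (z, s))).bind
      (fun v => (decode v : Option MachineAction)) = some a) :
    ustep z (encode (Sum.inr (k, s, f) : UState)) = lift k a := by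
  simp only [ustep, Denumerable.ofNat_encode, Sum.elim_inr, h]
  rfl

theorem universalMachine_universal : universalMachine.Universal := by
  intro M
  obtain ⟨k, hk⟩ := exists_code M
  refine ⟨List.replicate k false ++ [true], fun z p => ?_⟩
  set U := universalMachine
  set u := U.conf z (List.replicate k false ++ [true] ++ p) with hu
  set m := M.conf z p with hm
  -- the phase in which the prefix is read
  have start : ∀ t ≤ k, u t =
      ⟨encode (Sum.inl t : UState), List.replicate (k - t) false ++ [true] ++ p, []⟩ := by
    intro t
    induction t with
    | zero => intro _; rfl
    | succ t ih =>
      intro h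
      rw [hu, conf_succ, ← hu, ih (by omega), show k - t = (k - (t + 1)) + 1 by omega,
        List.replicate_succ]
      have := ustep_inl z t
      simp only [next, U, universalMachine, this]
      rfl
  have first : u (k + 1) = embed k 0 (m 0) := by
    rw [hu, conf_succ, ← hu, start k le_rfl]
    simp only [next, U, universalMachine, ustep_inl, Nat.sub_self]
    rfl
  have stepN : ∀ (f : ℕ) (C : Config), (Code.evaln f (Denumerable.ofNat Code k) (encode (z, C.state))).bind
      (fun v => (decode v : Option MachineAction)) = none →
      U.next z (embed k f C) = embed k (f + 1) C := by
    intro f C h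
    simp only [next, U, universalMachine, embed, ustep_none h]
  have stepS : ∀ (f : ℕ) (C : Config), (Code.evaln f (Denumerable.ofNat Code k) (encode (z, C.state))).bind
      (fun v => (decode v : Option MachineAction)) = some (M.step z C.state) →
      (∃ f', U.next z (embed k f C) = embed k f' (M.next z C)) ∧
      (U.Halted z (embed k f C) ↔ M.Halted z C) ∧ (U.Overrun z (embed k f C) ↔ M.Overrun z C) := by
    rintro f ⟨s, i, o⟩ h
    simp only [next, U, universalMachine, embed, Halted, Overrun, ustep_some h]
    cases hM : M.step z s with
    | compute s' => exact ⟨⟨0, rfl⟩, by simp [lift, MachineAction.equivSum]⟩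
    | read s₀ s₁ =>
      refine ⟨?_, by simp [lift, MachineAction.equivSum]⟩
      cases i with
      | nil => exact ⟨f, rfl⟩
      | cons b l => exact ⟨0, by cases b <;> rfl⟩
    | write x s' => exact ⟨⟨0, rfl⟩, by simp [lift, MachineAction.equivSum]⟩
    | halt => exact ⟨⟨f, rfl⟩, by simp [lift, MachineAction.equivSum]⟩
  -- every later configuration of `U` is one of `M`
  have fwd : ∀ t, ∃ t' f, u (k + 1 + t) = embed k f (m t') := by
    intro t
    induction t with
    | zero => exact ⟨0, 0, first⟩
    | succ t ih =>
      obtain ⟨t', f, h⟩ := ih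
      rw [← Nat.add_assoc, hu, conf_succ, ← hu, h]
      rcases (hk z (m t').state).2 f with h' | h'
      · exact ⟨t', f + 1, stepN _ _ h'⟩
      · obtain ⟨f', hf'⟩ := (stepS f (m t') h').1
        exact ⟨t' + 1, f', by rw [hf', hm, conf_succ]⟩
  -- the evaluation of the step function terminates
  have wait : ∀ C t f, u t = embed k f C → ∃ t' f', u t' = embed k f' C ∧
      (Code.evaln f' (Denumerable.ofNat Code k) (encode (z, C.state))).bind
        (fun v => (decode v : Option MachineAction)) = some (M.step z C.state) := by
    intro C t f h
    by_contra! hcon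
    obtain ⟨F, hF⟩ := (hk z C.state).1
    have all : ∀ j, u (t + j) = embed k (f + j) C := by
      intro j
      induction j with
      | zero => exact h
      | succ j ih =>
        rw [← Nat.add_assoc, hu, conf_succ, ← hu, ih]
        rcases (hk z C.state).2 (f + j) with h' | h'
        · exact stepN _ _ h'
        · exact absurd h' (hcon _ _ ih)
    refine hcon _ _ (all F) ?_
    rcases hv : Code.evaln F (Denumerable.ofNat Code k) (encode (z, C.state)) with _ | v
    · rw [hv] at hF; cases hF
    · have := Code.evaln_mono (Nat.le_add_left F f) (Option.mem_def.2 hv)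
      rw [Option.mem_def.1 this, ← hv, hF]
  have bwd : ∀ t', ∃ t f, u t = embed k f (m t') ∧
      (Code.evaln f (Denumerable.ofNat Code k) (encode (z, (m t').state))).bind
        (fun v => (decode v : Option MachineAction)) = some (M.step z (m t').state) := by
    intro t'
    induction t' with
    | zero => exact wait _ _ _ first
    | succ t' ih =>
      obtain ⟨t, f, h, h'⟩ := ih
      obtain ⟨f', hf'⟩ := (stepS f (m t') h').1
      refine wait _ (t + 1) f' ?_
      rw [hu, conf_succ, ← hu, h, hf', hm, conf_succ]
  have early : ∀ t ≤ k, ¬ U.Halted z (u t) ∧ ¬ U.Overrun z (u t) ∧ (u t).output = [] := by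
    intro t ht
    rw [start t ht]
    simp only [Halted, Overrun, U, universalMachine, ustep_inl]
    simp
  have split : ∀ t, t ≤ k ∨ ∃ t' f, u t = embed k f (m t') := by
    intro t
    rcases Nat.lt_or_ge k t with h | h
    · obtain ⟨j, rfl⟩ := Nat.exists_eq_add_of_lt h
      right
      have := fwd j
      rwa [show k + 1 + j = k + j + 1 by omega] at this
    · exact Or.inl h
  have noneStep : ∀ (f : ℕ) (C : Config), (Code.evaln f (Denumerable.ofNat Code k) (encode (z, C.state))).bind
      (fun v => (decode v : Option MachineAction)) = none →
      ¬ U.Halted z (embed k f C) ∧ ¬ U.Overrun z (embed k f C) := by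
    intro f C h
    simp only [Halted, Overrun, U, universalMachine, embed, ustep_none h]
    simp
  suffices (∀ o, (∃ t, (u t).output = o) ↔ ∃ t, (m t).output = o) ∧
      (∀ i, (∃ t, U.Halted z (u t) ∧ (u t).input = i) ↔ ∃ t, M.Halted z (m t) ∧ (m t).input = i) ∧
      ((∃ t, U.Overrun z (u t)) ↔ ∃ t, M.Overrun z (m t)) from this
  refine ⟨fun o => ⟨?_, ?_⟩, fun i => ⟨?_, ?_⟩, ⟨?_, ?_⟩⟩
  · rintro ⟨t, rfl⟩
    rcases split t with h | ⟨t', f, h⟩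
    · exact ⟨0, (early t h).2.2.symm⟩
    · exact ⟨t', by rw [h]; rfl⟩
  · rintro ⟨t', rfl⟩
    obtain ⟨t, f, h, -⟩ := bwd t'
    exact ⟨t, by rw [h]; rfl⟩
  · rintro ⟨t, hh, rfl⟩
    rcases split t with h | ⟨t', f, h⟩
    · exact absurd hh (early t h).1
    · rw [h] at hh ⊢
      rcases (hk z (m t').state).2 f with h' | h'
      · exact absurd hh (noneStep _ _ h').1
      · exact ⟨t', (stepS _ _ h').2.1.1 hh, rfl⟩
  · rintro ⟨t', hh, rfl⟩
    obtain ⟨t, f, h, h'⟩ := bwd t'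
    exact ⟨t, by rw [h]; exact (stepS _ _ h').2.1.2 hh, by rw [h]; rfl⟩
  · rintro ⟨t, hh⟩
    rcases split t with h | ⟨t', f, h⟩
    · exact absurd hh (early t h).2.1
    · rw [h] at hh
      rcases (hk z (m t').state).2 f with h' | h'
      · exact absurd hh (noneStep _ _ h').2
      · exact ⟨t', (stepS _ _ h').2.2.1 hh⟩
  · rintro ⟨t', hh⟩
    obtain ⟨t, f, h, h'⟩ := bwd t'
    exact ⟨t, by rw [h]; exact (stepS _ _ h').2.2.2 hh⟩

end Machine

end

/-! Let `B` be a unitary matrix whose entries can be computed from the auxiliary data. Two facts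
carry the theorem.

First, the map φ ↦ Bφ on elementary states is computable, so 𝐦(φ) ≤ 2^k 𝐦(Bφ), where k depends only
on `U` and on the way the entries of `B` are read off the auxiliary data. Since φ ↦ Bφ is injective,
summation over φ gives BμB* ≤ 2^k μ (`conj_universalMatrix_le`).

Second, put Tν = 2^(-k) (B ⊗ 1)* ν (B ⊗ 1). This map preserves product form, and Tr Tν(μ ⊗ μ) =
2^(-k) Tr ν(BμB* ⊗ μ) ≤ Tr ν(μ ⊗ μ) ≤ 1. A fixed prefix turns every program that lower computes ν
into one that lower computes Tν (`LowerComputes.map`). Hence T maps the product tests injectively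
into themselves and lowers their weights by at most a factor 2^m. Comparing the series of Tr 𝕮(BσB*
⊗ ρ) with that of Tr 𝕮(σ ⊗ ρ) along ν ↦ Tν costs a factor 2^(m+k)
(`Universal.exists_trace_aggregatedTest_le`). The choice B = A gives one inequality; B = A*, applied
to AσA*, gives the other.

Convergence: by Kraft's inequality all weights add up to at most 1. Every basis state has positive
probability, so μ ≥ c·1 for some c > 0; a test therefore has trace at most c^(-2), which bounds its
entries.

What remains is effectivity: matrix products on codes of rational entries in lowest terms are
primitive recursive, uniformly in the dimension. -/

noncomputable section

/-! ### Runs of a machine: growth of the output, halting, continued inputs. -/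

namespace Machine

variable (U : Machine) (z : List ℕ)

theorem output_prefix_conf_succ (p : List Bool) (t : ℕ) :
    (U.conf z p t).output <+: (U.conf z p (t + 1)).output := by
  rw [conf_succ]
  unfold next
  split
  · simp
  · split <;> simp
  · simp
  · simp

theorem output_prefix_conf (p : List Bool) {t t' : ℕ} (h : t ≤ t') :
    (U.conf z p t).output <+: (U.conf z p t').output := by
  induction t', h using Nat.le_induction with
  | base => simp
  | succ t' _ ih => exact ih.trans (U.output_prefix_conf_succ z p t')

variable {U z}

theorem Halted.conf_eq {p : List Bool} {t t' : ℕ} (h : U.Halted z (U.conf z p t)) (ht : t ≤ t') :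
    U.conf z p t' = U.conf z p t := by
  induction t', ht using Nat.le_induction with
  | base => rfl
  | succ t' _ ih =>
    rw [conf_succ, ih]
    have h : U.step z (U.conf z p t).state = .halt := h
    simp [next, h]

theorem Halted.conf_unique {p : List Bool} {t t' : ℕ} (h : U.Halted z (U.conf z p t))
    (h' : U.Halted z (U.conf z p t')) : U.conf z p t = U.conf z p t' := by
  rcases le_total t t' with ht | ht
  · exact (h.conf_eq ht).symm
  · exact h'.conf_eq ht

theorem Outputs.unique {p : List Bool} {x y : ℕ} (hx : U.Outputs z p x) (hy : U.Outputs z p y) :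
    x = y := by
  obtain ⟨t, h, -, ho⟩ := hx
  obtain ⟨t', h', -, ho'⟩ := hy
  rw [h.conf_unique h', ho'] at ho
  simpa using ho.symm

/-- As long as a machine does not overrun its input `p`, it does not notice that the input is
continued by `s`. -/
theorem conf_append (p s : List Bool) (t : ℕ) :
    U.Overrun z (U.conf z p t) ∨ U.conf z (p ++ s) t =
      ⟨(U.conf z p t).state, (U.conf z p t).input ++ s, (U.conf z p t).output⟩ := by
  induction t with
  | zero => right; rfl
  | succ t ih =>
    rw [conf_succ, conf_succ]
    rcases ih with ih | ih
    -- A configuration that overruns the input is a fixed point of the step function, so the overrun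
    -- persists.
    · left
      obtain ⟨h₁, s₀, s₁, h₂⟩ := id ih
      simpa [next, h₁, h₂] using ih
    · rw [ih]
      obtain ⟨st, i, o⟩ := U.conf z p t
      simp only [next, Overrun]
      cases hs : U.step z st with
      | compute s' => right; rfl
      | read s₀ s₁ =>
        cases i with
        | nil => left; simp [hs]
        | cons b l => right; rfl
      | write x s' => right; rfl
      | halt => right; rfl

/-- On the longer input the run is the same and halts with the added bits unread; since a program
must be read completely, no bits were added. This makes the halting programs prefix-free. -/
theorem Outputs.eq_of_prefix {p q : List Bool} {x y : ℕ} (hp : U.Outputs z p x)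
    (hq : U.Outputs z q y) (h : p <+: q) : p = q := by
  obtain ⟨s, rfl⟩ := h
  obtain ⟨t, h, hi, -⟩ := hp
  obtain ⟨t', h', hi', -⟩ := hq
  rcases conf_append (U := U) (z := z) p s t with ⟨-, s₀, s₁, h''⟩ | h''
  · rw [Halted, h''] at h; cases h
  · have h2 : U.Halted z (U.conf z (p ++ s) t) := by rw [h'']; exact h
    have := h2.conf_unique h'
    rw [← this, h''] at hi'
    simp at hi'
    simp [hi'.2]

/-! ### Kraft's inequality and the total universal probability. -/

/-- A prefix-free set that does not contain the empty word is uniquely decodable. -/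
theorem uniquelyDecodable_of_prefixFree {α : Type*} {S : Set (List α)} (h0 : [] ∉ S)
    (h : ∀ p ∈ S, ∀ q ∈ S, p <+: q → p = q) : InformationTheory.UniquelyDecodable S := by
  intro L₁
  induction L₁ with
  | nil =>
    intro L₂ _ h₂ he
    cases L₂ with
    | nil => rfl
    | cons q L₂ =>
      simp only [List.flatten_nil, List.flatten_cons] at he
      have : q = [] := by simpa using (List.append_eq_nil_iff.1 he.symm).1
      exact absurd (this ▸ h₂ q (by simp)) h0
  | cons p L₁ ih =>
    intro L₂ h₁ h₂ he
    cases L₂ with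
    | nil =>
      simp only [List.flatten_nil, List.flatten_cons] at he
      have : p = [] := by simpa using (List.append_eq_nil_iff.1 he).1
      exact absurd (this ▸ h₁ p (by simp)) h0
    | cons q L₂ =>
      simp only [List.flatten_cons] at he
      have hpq : p = q := by
        -- The first words of two factorizations are prefixes of one word, hence comparable, hence
        -- equal.
        have a : p <+: q ++ L₂.flatten := he ▸ List.prefix_append _ _
        rcases List.prefix_or_prefix_of_prefix a (List.prefix_append q L₂.flatten) with h' | h'
        · exact h _ (h₁ p (by simp)) _ (h₂ q (by simp)) h'
        · exact (h _ (h₂ q (by simp)) _ (h₁ p (by simp)) h').symm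
      subst hpq
      rw [ih L₂ (fun w hw => h₁ w (by simp [hw])) (fun w hw => h₂ w (by simp [hw]))
        (List.append_cancel_left he)]

/-- Kraft's inequality for prefix-free sets of binary words. -/
theorem tsum_two_inv_pow_length_le_one (S : Set (List Bool))
    (h : ∀ p ∈ S, ∀ q ∈ S, p <+: q → p = q) :
    ∑' p : S, (2 : ℝ≥0∞)⁻¹ ^ p.1.length ≤ 1 := by
  -- Unique decodability fails in the presence of the empty word; but a prefix-free set containing
  -- it has no other element.
  by_cases h0 : [] ∈ S
  · have hS : S = {[]} := by
      ext p
      simp only [Set.mem_singleton_iff]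
      exact ⟨fun hp => (h _ h0 _ hp List.nil_prefix).symm, fun hp => hp ▸ h0⟩
    subst hS
    rw [tsum_singleton ([] : List Bool) fun p => (2 : ℝ≥0∞)⁻¹ ^ p.length]
    simp
  -- The Kraft–McMillan inequality concerns finite codes, so it is applied to the finite partial
  -- sums.
  · rw [ENNReal.tsum_eq_iSup_sum]
    refine iSup_le fun s => ?_
    have hu : InformationTheory.UniquelyDecodable
        ((s.map (Function.Embedding.subtype _) : Finset (List Bool)) : Set (List Bool)) := by
      refine uniquelyDecodable_of_prefixFree (fun h' => h0 ?_) fun p hp q hq => h p ?_ q ?_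
      · simp_all
      · simp only [Finset.coe_map, Set.mem_image] at hp
        obtain ⟨a, -, rfl⟩ := hp
        exact a.2
      · simp only [Finset.coe_map, Set.mem_image] at hq
        obtain ⟨a, -, rfl⟩ := hq
        exact a.2
    have k := InformationTheory.kraft_mcmillan_inequality hu
    rw [Finset.sum_map] at k
    have : ∑ a ∈ s, (2 : ℝ≥0∞)⁻¹ ^ a.1.length =
        ENNReal.ofReal (∑ a ∈ s, (1 / Fintype.card Bool : ℝ) ^ a.1.length) := by
      rw [ENNReal.ofReal_sum_of_nonneg fun _ _ => by positivity]
      refine Finset.sum_congr rfl fun a _ => ?_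
      rw [ENNReal.ofReal_pow (by positivity)]
      simp [ENNReal.ofReal_inv_of_pos]
    rw [this]
    exact ENNReal.ofReal_le_one.2 k

variable (U z)

/-- A program has at most one output, so the double sum runs over each halting program at most once,
and Kraft's inequality applies. -/
theorem tsum_prob_le_one : ∑' x, U.prob x z ≤ 1 := by
  unfold prob
  rw [← ENNReal.tsum_sigma' (fun a : Σ x, {p : List Bool // U.Outputs z p x} =>
    (2 : ℝ≥0∞)⁻¹ ^ a.2.1.length)]
  set S : Set (List Bool) := {p | ∃ x, U.Outputs z p x}
  let f : (Σ x, {p : List Bool // U.Outputs z p x}) → S := fun a => ⟨a.2.1, a.1, a.2.2⟩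
  have hf : Function.Injective f := by
    rintro ⟨x, p, hp⟩ ⟨y, q, hq⟩ h
    have h : p = q := congrArg Subtype.val h
    subst h
    obtain rfl := hp.unique hq
    rfl
  calc _ ≤ ∑' p : S, (2 : ℝ≥0∞)⁻¹ ^ p.1.length :=
        ENNReal.tsum_comp_le_tsum_of_injective hf fun p : S => (2 : ℝ≥0∞)⁻¹ ^ p.1.length
    _ ≤ 1 := tsum_two_inv_pow_length_le_one S fun p ⟨_, hp⟩ q ⟨_, hq⟩ => hp.eq_of_prefix hq

theorem prob_ne_top (x : ℕ) : U.prob x z ≠ ∞ :=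
  ((ENNReal.le_tsum x).trans (U.tsum_prob_le_one z)).trans_lt ENNReal.one_lt_top |>.ne

variable {U z}

/-! ### Computable post-processing of the output. -/

/-- The machine that behaves as `U`, but writes `g z x` instead of `x`. -/
def mapOut (U : Machine) (g : List ℕ → ℕ → ℕ) (hg : Computable₂ g) : Machine where
  step z s := MachineAction.equivSum.symm ((MachineAction.equivSum (U.step z s)).elim Sum.inl
    fun o => Sum.inr (o.map fun x => (g z x.1, x.2)))
  computable_step := by
    have he : Primrec MachineAction.equivSum := Primrec.of_equiv
    have hs : Primrec MachineAction.equivSum.symm := Primrec.of_equiv_symm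
    refine hs.to_comp.comp (Computable.sumCasesOn (he.to_comp.comp U.computable_step) ?_ ?_)
    · exact Computable.sumInl.comp Computable.snd
    · refine Computable.sumInr.comp (Computable.option_map Computable.snd ?_)
      exact (hg.comp (Computable.fst.comp (Computable.fst.comp Computable.fst))
        (Computable.fst.comp Computable.snd)).pair (Computable.snd.comp Computable.snd)

theorem mapOut_step {g : List ℕ → ℕ → ℕ} (hg : Computable₂ g) (s : ℕ) :
    (U.mapOut g hg).step z s = match U.step z s with
      | .write x s' => .write (g z x) s'
      | a => a := by
  simp only [mapOut]
  cases U.step z s <;> rfl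

theorem conf_mapOut {g : List ℕ → ℕ → ℕ} (hg : Computable₂ g) (p : List Bool) (t : ℕ) :
    (U.mapOut g hg).conf z p t =
      ⟨(U.conf z p t).state, (U.conf z p t).input, (U.conf z p t).output.map (g z)⟩ := by
  induction t with
  | zero => rfl
  | succ t ih =>
    rw [conf_succ, conf_succ, ih]
    obtain ⟨s, i, o⟩ := U.conf z p t
    simp only [next, mapOut_step]
    cases U.step z s with
    | compute s' => rfl
    | read s₀ s₁ => cases i <;> rfl
    | write x s' => simp
    | halt => rfl

theorem halted_mapOut {g : List ℕ → ℕ → ℕ} (hg : Computable₂ g) (p : List Bool) (t : ℕ) :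
    (U.mapOut g hg).Halted z ((U.mapOut g hg).conf z p t) ↔ U.Halted z (U.conf z p t) := by
  simp only [Halted, conf_mapOut, mapOut_step]
  cases U.step z (U.conf z p t).state <;> simp

theorem overrun_mapOut {g : List ℕ → ℕ → ℕ} (hg : Computable₂ g) (p : List Bool) (t : ℕ) :
    (U.mapOut g hg).Overrun z ((U.mapOut g hg).conf z p t) ↔ U.Overrun z (U.conf z p t) := by
  simp only [Overrun, conf_mapOut, mapOut_step]
  cases U.step z (U.conf z p t).state <;> simp

/-- `BehavesAs` compares the outputs that occur at some time, not at corresponding times. Outputs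
only grow and are frozen after halting, so on either side the output at the halting time is the
longest; each of the two is then a prefix of the other. -/
theorem BehavesAs.outputs {M : Machine} {p q : List Bool} (h : U.BehavesAs M z p q) {x : ℕ}
    (hx : M.Outputs z q x) : U.Outputs z p x := by
  obtain ⟨t, ht, hi, ho⟩ := hx
  obtain ⟨u, hu, hui⟩ := (h.2.1 []).2 ⟨t, ht, hi⟩
  refine ⟨u, hu, hui, ?_⟩
  have h₁ : [x] <+: (U.conf z p u).output := by
    obtain ⟨v, hv⟩ := (h.1 [x]).2 ⟨t, ho⟩
    rw [← hv]
    rcases le_total v u with h' | h'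
    · exact U.output_prefix_conf z p h'
    · rw [hu.conf_eq h']
  have h₂ : (U.conf z p u).output <+: [x] := by
    obtain ⟨v, hv⟩ := (h.1 _).1 ⟨u, rfl⟩
    rw [← hv, ← ho]
    rcases le_total v t with h' | h'
    · exact M.output_prefix_conf z q h'
    · rw [ht.conf_eq h']
  exact h₂.eq_of_length_le h₁.length_le

/-- A universal machine can apply a computable function to its output. -/
theorem Universal.exists_prefix (hU : U.Universal) {g : List ℕ → ℕ → ℕ} (hg : Computable₂ g) :
    ∃ r : List Bool, ∀ z p, U.BehavesAs (U.mapOut g hg) z (r ++ p) p :=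
  hU _

/-- Prefixing `r` is an injection between the two sets of programs that divides every weight by `2 ^
r.length`. -/
theorem prob_le_prob_of_append {r : List Bool} {x y : ℕ}
    (h : ∀ p, U.Outputs z p x → U.Outputs z (r ++ p) y) :
    U.prob x z ≤ 2 ^ r.length * U.prob y z := by
  unfold prob
  let f : {p : List Bool // U.Outputs z p x} → {p : List Bool // U.Outputs z p y} :=
    fun p => ⟨r ++ p.1, h _ p.2⟩
  have hf : Function.Injective f := by
    rintro ⟨p, hp⟩ ⟨q, hq⟩ hpq
    simpa [f] using hpq
  calc _ = 2 ^ r.length * ∑' p, (2 : ℝ≥0∞)⁻¹ ^ (f p).1.length := by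
        rw [← ENNReal.tsum_mul_left]
        refine tsum_congr fun p => ?_
        simp only [f, List.length_append, pow_add]
        rw [← mul_assoc, ← mul_pow, ENNReal.mul_inv_cancel (by simp) (by simp), one_pow, one_mul]
    _ ≤ _ := by
        gcongr
        exact ENNReal.tsum_comp_le_tsum_of_injective hf
          fun p : {p : List Bool // U.Outputs z p y} => (2 : ℝ≥0∞)⁻¹ ^ p.1.length

/-- The universal probability decreases by at most a constant factor under computable maps. -/
theorem Universal.exists_prob_le (hU : U.Universal) {g : List ℕ → ℕ → ℕ} (hg : Computable₂ g) :
    ∃ k : ℕ, ∀ z x, U.prob x z ≤ 2 ^ k * U.prob (g z x) z := by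
  obtain ⟨r, hr⟩ := hU.exists_prefix hg
  refine ⟨r.length, fun z x => prob_le_prob_of_append fun p hp => (hr z p).outputs ?_⟩
  obtain ⟨t, ht, hi, ho⟩ := hp
  exact ⟨t, (halted_mapOut hg p t).2 ht, by rw [conf_mapOut, hi], by rw [conf_mapOut, ho]; rfl⟩

/-- The machine that writes `x` and halts. -/
def constant (x : ℕ) : Machine where
  step _ s := if s = 0 then MachineAction.equivSum.symm (.inr (some (x, 1))) else
    MachineAction.equivSum.symm (.inr none)
  computable_step := by
    have hs : Primrec MachineAction.equivSum.symm := Primrec.of_equiv_symm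
    refine Primrec.to_comp (Primrec.ite (Primrec.eq.comp Primrec.snd (Primrec.const 0)) ?_ ?_)
    · exact hs.comp (Primrec.const _)
    · exact hs.comp (Primrec.const _)

/-- Positivity of the weights of the basis states is what makes the universal matrix positive
definite. -/
theorem Universal.prob_ne_zero (hU : U.Universal) (x : ℕ) (z : List ℕ) : U.prob x z ≠ 0 := by
  obtain ⟨r, hr⟩ := hU (constant x)
  have hx : U.Outputs z (r ++ []) x := (hr z []).outputs ⟨1, rfl, rfl, rfl⟩
  unfold prob
  intro h
  have := ENNReal.tsum_eq_zero.1 h ⟨_, hx⟩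
  simp at this

end Machine

theorem fractions_injective : Function.Injective fractions := by
  rintro ⟨a, b⟩ ⟨a', b'⟩ h
  simp only [fractions, Prod.mk.injEq] at h
  exact Prod.ext (Rat.ext h.1.1 h.1.2) (Rat.ext h.2.1 h.2.2)

/-- Distinct states occupy distinct numbers, so their probabilities form part of the sum over all
outputs, which is at most 1. -/
theorem vecCode_injective {d : ℕ} :
    Function.Injective (vecCode : (Fin d → ℚ × ℚ) → ℕ) := by
  intro v w h
  have := List.ofFn_injective (Encodable.encode_injective h)
  exact funext fun i => fractions_injective (congrFun this i)

theorem matCode_injective {d : ℕ} : Function.Injective (matCode : EMatrix d → ℕ) := by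
  intro M N h
  have := List.ofFn_injective (Encodable.encode_injective h)
  exact Matrix.ext fun i j => fractions_injective
    (congrFun (List.ofFn_injective (congrFun this i)) j)

/-! ### Lower computation of matrices and its images under positive linear maps. -/

namespace Machine

variable {U : Machine} {z : List ℕ} {d : ℕ}

/-- Codes are injective, so the run determines the sequence of matrices and thereby its limit. This
lets the weights of different tests be summed over disjoint sets of programs. -/
theorem LowerComputes.unique {q : List Bool} {σ τ : Matrix (Fin d) (Fin d) ℂ}
    (hσ : U.LowerComputes z q σ) (hτ : U.LowerComputes z q τ) : σ = τ := by
  obtain ⟨-, L, hL, -, -, -, hl⟩ := hσ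
  obtain ⟨-, L', hL', -, -, -, hl'⟩ := hτ
  have : L = L' := funext fun t => List.map_injective_iff.2 matCode_injective
    ((hL t).symm.trans (hL' t))
  subst this
  exact tendsto_nhds_unique hl hl'

theorem isClosed_posSemidef : IsClosed {M : Matrix (Fin d) (Fin d) ℂ | M.PosSemidef} := by
  simp only [Matrix.posSemidef_iff_dotProduct_mulVec, Set.ofPred_and]
  refine IsClosed.inter (isClosed_eq ?_ ?_) ?_
  · fun_prop
  · fun_prop
  · simp only [Set.ofPred_forall]
    exact isClosed_iInter fun x => isClosed_le continuous_const (by fun_prop)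

theorem LowerComputes.posSemidef {q : List Bool} {σ : Matrix (Fin d) (Fin d) ℂ}
    (h : U.LowerComputes z q σ) : σ.PosSemidef := by
  obtain ⟨-, L, -, hp, -, -, hl⟩ := h
  refine isClosed_posSemidef.mem_of_tendsto hl (Filter.Eventually.of_forall fun t => ?_)
  cases ht : (L t).getLast? with
  -- Before anything is written the approximation is the default value 0, which is positive
  -- semidefinite.
  | none => exact Matrix.PosSemidef.zero
  | some M => exact hp t M (List.mem_of_getLast? ht)

/-- If a program lower computes `σ`, then every program on which `U` writes the images of the
same matrices under a positive linear map `T` lower computes `T σ`. -/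
theorem LowerComputes.map {q q' : List Bool} {σ : Matrix (Fin d) (Fin d) ℂ}
    (h : U.LowerComputes z q σ) {g : List ℕ → ℕ → ℕ} {hg : Computable₂ g}
    (hb : U.BehavesAs (U.mapOut g hg) z q' q)
    (T : Matrix (Fin d) (Fin d) ℂ →ₗ[ℂ] Matrix (Fin d) (Fin d) ℂ)
    (hT : ∀ M : Matrix (Fin d) (Fin d) ℂ, M.PosSemidef → (T M).PosSemidef)
    (e : EMatrix d → EMatrix d) (he : ∀ M, (e M).val = T M.val)
    (hge : ∀ M : EMatrix d, g z (matCode M) = matCode (e M)) :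
    U.LowerComputes z q' (T σ) := by
  obtain ⟨ho, L, hL, hp, hi, ⟨t₀, h₀⟩, hl⟩ := h
  have hout : ∀ t, ((U.mapOut g hg).conf z q t).output = ((L t).map e).map matCode := by
    intro t
    simp [conf_mapOut, hL, hge]
  -- The two runs show the same outputs but at different times; `s` translates the times of `U` into
  -- times of the simulated machine and need not be monotone.
  have hs : ∀ t, ∃ s, (U.conf z q' t).output = ((L s).map e).map matCode := by
    intro t
    obtain ⟨s, hs⟩ := (hb.1 _).1 ⟨t, rfl⟩
    exact ⟨s, by rw [← hs, hout]⟩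
  have hs' : ∀ s, ∃ t, (U.conf z q' t).output = ((L s).map e).map matCode := fun s =>
    (hb.1 _).2 ⟨s, hout s⟩
  choose s hs using hs
  have hinj : Function.Injective (List.map (matCode : EMatrix d → ℕ)) :=
    List.map_injective_iff.2 matCode_injective
  refine ⟨fun t ht => ?_, fun t => (L (s t)).map e, hs, ?_, ?_, ?_, ?_⟩
  · obtain ⟨u, hu⟩ := hb.2.2.1 ⟨t, ht⟩
    exact ho u ((overrun_mapOut hg q u).1 hu)
  · intro t M hM
    obtain ⟨N, hN, rfl⟩ := List.mem_map.1 hM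
    rw [he]
    exact hT _ (hp _ N hN)
  · intro t
    rw [List.pairwise_map]
    refine (hi (s t)).imp fun {M N} hMN => ?_
    rw [he, he, ← map_sub]
    exact hT _ hMN
  · obtain ⟨t, ht⟩ := hs' t₀
    refine ⟨t, fun h => h₀ ?_⟩
    have := hinj ((hs t).symm.trans ht)
    rw [show (L (s t)).map e = [] from h] at this
    simpa using this.symm
  · have hlast : ∀ l : List (EMatrix d),
        (l.map e).getLast?.elim 0 EMatrix.val = T (l.getLast?.elim 0 EMatrix.val) := by
      intro l
      rw [List.getLast?_map]
      cases l.getLast? <;> simp [he]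
    have hc : Continuous T := T.continuous_of_finiteDimensional
    have hl' := (hc.tendsto σ).comp hl
    rw [Filter.tendsto_atTop'] at hl' ⊢
    intro S hS
    obtain ⟨n, hn⟩ := hl' S hS
    obtain ⟨u, hu⟩ := hs' n
    refine ⟨u, fun t ht => ?_⟩
    rw [hlast]
    -- If `s t` lies before `n`, the output of the simulated machine at time `s t` is a prefix of
    -- that at time `n`. The same two lists are the outputs of `U` at the times `t` and `u ≤ t`,
    -- which gives the reverse prefix relation. So they agree, and the estimate at time `n` applies.
    rcases le_total n (s t) with hnt | hnt
    · exact hn _ hnt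
    · have h₁ := U.output_prefix_conf z q' ht
      have h₂ := (U.mapOut g hg).output_prefix_conf z q hnt
      rw [hout, hout, ← hu, ← hs] at h₂
      have h₃ := h₂.eq_of_length_le h₁.length_le
      rw [hs, hu] at h₃
      rw [← hlast, hinj h₃, hlast]
      exact hn n le_rfl

/-- This transfers the weight of a program for a test to the prefixed program for the transformed
test. -/
theorem Universal.exists_prob_append_le (hU : U.Universal) (r : List Bool) :
    ∃ k : ℕ, ∀ z q, U.prob (Encodable.encode q) z ≤
      2 ^ k * U.prob (Encodable.encode (r ++ q)) z := by
  have hg : Computable₂ fun (_ : List ℕ) (x : ℕ) => Encodable.encode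
      (r ++ ((Encodable.decode x : Option (List Bool)).getD [])) := by
    refine Primrec.to_comp (Primrec.encode.comp (Primrec.list_append.comp (Primrec.const r) ?_))
    exact Primrec.option_getD.comp (Primrec.decode.comp Primrec.snd) (Primrec.const [])
  obtain ⟨k, hk⟩ := hU.exists_prob_le hg
  exact ⟨k, fun z q => by simpa using hk z (Encodable.encode q)⟩

end Machine

/-! ### Computations with rational numbers -/

/-- The rational function `f` is the quotient of a difference of two primitive recursive functions
and a primitive recursive function. -/
def RatPrimrec {α : Type*} [Primcodable α] (f : α → ℚ) : Prop :=
  ∃ a b d : α → ℕ, Primrec a ∧ Primrec b ∧ Primrec d ∧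
    ∀ x, d x ≠ 0 ∧ f x = ((a x : ℚ) - b x) / d x

namespace RatPrimrec

variable {α β : Type*} [Primcodable α] [Primcodable β] {f g : α → ℚ}

theorem comp {f : β → ℚ} (hf : RatPrimrec f) {h : α → β} (hh : Primrec h) :
    RatPrimrec fun x => f (h x) := by
  obtain ⟨a, b, d, ha, hb, hd, hf⟩ := hf
  exact ⟨_, _, _, ha.comp hh, hb.comp hh, hd.comp hh, fun x => hf (h x)⟩

theorem const (q : ℚ) : RatPrimrec fun _ : α => q := by
  refine ⟨fun _ => q.num.toNat, fun _ => (-q.num).toNat, fun _ => q.den, Primrec.const _,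
    Primrec.const _, Primrec.const _, fun _ => ⟨q.den_nz, ?_⟩⟩
  have : (q.num.toNat : ℤ) - (-q.num).toNat = q.num := by omega
  have : (q.num.toNat : ℚ) - (-q.num).toNat = q.num := by exact_mod_cast this
  rw [this, Rat.num_div_den]

theorem neg (hf : RatPrimrec f) : RatPrimrec fun x => -f x := by
  obtain ⟨a, b, d, ha, hb, hd, hf⟩ := hf
  exact ⟨b, a, d, hb, ha, hd, fun x => ⟨(hf x).1, by simp only [(hf x).2]; ring⟩⟩

theorem add (hf : RatPrimrec f) (hg : RatPrimrec g) : RatPrimrec fun x => f x + g x := by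
  obtain ⟨a, b, d, ha, hb, hd, hf⟩ := hf
  obtain ⟨a', b', d', ha', hb', hd', hg⟩ := hg
  refine ⟨fun x => a x * d' x + a' x * d x, fun x => b x * d' x + b' x * d x, fun x => d x * d' x,
    ?_, ?_, ?_, fun x => ⟨mul_ne_zero (hf x).1 (hg x).1, ?_⟩⟩
  · exact Primrec.nat_add.comp (Primrec.nat_mul.comp ha hd') (Primrec.nat_mul.comp ha' hd)
  · exact Primrec.nat_add.comp (Primrec.nat_mul.comp hb hd') (Primrec.nat_mul.comp hb' hd)
  · exact Primrec.nat_mul.comp hd hd'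
  · have h₁ : (d x : ℚ) ≠ 0 := by exact_mod_cast (hf x).1
    have h₂ : (d' x : ℚ) ≠ 0 := by exact_mod_cast (hg x).1
    simp only [(hf x).2, (hg x).2]
    push_cast
    field_simp
    ring

theorem sub (hf : RatPrimrec f) (hg : RatPrimrec g) : RatPrimrec fun x => f x - g x := by
  simpa only [sub_eq_add_neg] using hf.add hg.neg

theorem mul (hf : RatPrimrec f) (hg : RatPrimrec g) : RatPrimrec fun x => f x * g x := by
  obtain ⟨a, b, d, ha, hb, hd, hf⟩ := hf
  obtain ⟨a', b', d', ha', hb', hd', hg⟩ := hg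
  refine ⟨fun x => a x * a' x + b x * b' x, fun x => a x * b' x + b x * a' x, fun x => d x * d' x,
    ?_, ?_, ?_, fun x => ⟨mul_ne_zero (hf x).1 (hg x).1, ?_⟩⟩
  · exact Primrec.nat_add.comp (Primrec.nat_mul.comp ha ha') (Primrec.nat_mul.comp hb hb')
  · exact Primrec.nat_add.comp (Primrec.nat_mul.comp ha hb') (Primrec.nat_mul.comp hb ha')
  · exact Primrec.nat_mul.comp hd hd'
  · simp only [(hf x).2, (hg x).2, div_mul_div_comm]
    push_cast
    ring

/-- Primitive recursion on the number of terms carries a triple: positive part and negative part of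
the numerator, and the product of the denominators. The number of terms may depend on the argument,
as needed for matrices of variable dimension. -/
theorem sum_range {f : α × ℕ → ℚ} (hf : RatPrimrec f) {D : α → ℕ} (hD : Primrec D) :
    RatPrimrec fun x => ∑ k ∈ Finset.range (D x), f (x, k) := by
  obtain ⟨a, b, d, ha, hb, hd, hf⟩ := hf
  let r : α → ℕ → ℕ × ℕ × ℕ := fun x n => Nat.rec (0, 0, 1)
    (fun k s => (s.1 * d (x, k) + a (x, k) * s.2.2, s.2.1 * d (x, k) + b (x, k) * s.2.2,
      s.2.2 * d (x, k))) n
  have hr : Primrec fun x => r x (D x) := by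
    have hx : Primrec fun p : α × ℕ × ℕ × ℕ × ℕ => (p.1, p.2.1) :=
      Primrec.fst.pair (Primrec.fst.comp Primrec.snd)
    have hs : Primrec fun p : α × ℕ × ℕ × ℕ × ℕ => p.2.2 := Primrec.snd.comp Primrec.snd
    have h₁ := Primrec.fst.comp hs
    have h₂ := Primrec.fst.comp (Primrec.snd.comp hs)
    have h₃ := Primrec.snd.comp (Primrec.snd.comp hs)
    exact Primrec.nat_rec' hD (Primrec.const _) (Primrec.to₂ <|
      (Primrec.nat_add.comp (Primrec.nat_mul.comp h₁ (hd.comp hx))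
        (Primrec.nat_mul.comp (ha.comp hx) h₃)).pair <|
      (Primrec.nat_add.comp (Primrec.nat_mul.comp h₂ (hd.comp hx))
        (Primrec.nat_mul.comp (hb.comp hx) h₃)).pair <|
      Primrec.nat_mul.comp h₃ (hd.comp hx))
  have key : ∀ x n, (r x n).2.2 ≠ 0 ∧ ∑ k ∈ Finset.range n, f (x, k) =
      (((r x n).1 : ℚ) - (r x n).2.1) / (r x n).2.2 := by
    intro x n
    induction n with
    | zero => simp [r]
    | succ n ih =>
      have hn : r x (n + 1) = ((r x n).1 * d (x, n) + a (x, n) * (r x n).2.2,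
        (r x n).2.1 * d (x, n) + b (x, n) * (r x n).2.2, (r x n).2.2 * d (x, n)) := rfl
      have h₁ : ((r x n).2.2 : ℚ) ≠ 0 := by exact_mod_cast ih.1
      have h₂ : (d (x, n) : ℚ) ≠ 0 := by exact_mod_cast (hf (x, n)).1
      rw [hn]
      refine ⟨mul_ne_zero ih.1 (hf (x, n)).1, ?_⟩
      rw [Finset.sum_range_succ, ih.2, (hf (x, n)).2]
      push_cast
      field_simp
      ring
  exact ⟨_, _, _, Primrec.fst.comp hr, Primrec.fst.comp (Primrec.snd.comp hr),
    Primrec.snd.comp (Primrec.snd.comp hr), fun x => key x (D x)⟩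

end RatPrimrec

/-! ### Integers, greatest common divisors and reduction to lowest terms. -/

theorem Primrec.int_subNatNat : Primrec₂ Int.subNatNat := by
  -- The integer n ≥ 0 has the code 2n, and -(n+1) has the code 2n+1.
  refine Primrec.encode_iff.1 (Primrec.of_eq (f := fun p : ℕ × ℕ =>
    if p.2 ≤ p.1 then 2 * (p.1 - p.2) else 2 * (p.2 - p.1 - 1) + 1) ?_ ?_)
  · exact Primrec.ite (Primrec.nat_le.comp Primrec.snd Primrec.fst)
      (Primrec.nat_double.comp (Primrec.nat_sub.comp Primrec.fst Primrec.snd))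
      (Primrec.nat_double_succ.comp (Primrec.nat_sub.comp
        (Primrec.nat_sub.comp Primrec.snd Primrec.fst) (Primrec.const 1)))
  · rintro ⟨m, n⟩
    split_ifs with h
    · rw [Int.subNatNat_of_le h]; rfl
    · rw [Int.subNatNat_of_lt (not_le.1 h)]; rfl

theorem Primrec.int_toNat : Primrec Int.toNat := by
  refine Primrec.ofNat_iff.2 (Primrec.of_eq (f := fun n : ℕ => if n % 2 = 0 then n / 2 else 0)
    ?_ ?_)
  · exact Primrec.ite (Primrec.eq.comp (Primrec.nat_mod.comp Primrec.id (Primrec.const 2))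
      (Primrec.const 0)) (Primrec.nat_div.comp Primrec.id (Primrec.const 2)) (Primrec.const 0)
  · intro n
    obtain ⟨i, rfl⟩ := Equiv.intEquivNat.surjective n
    have : Denumerable.ofNat ℤ (Equiv.intEquivNat i) = i := Equiv.intEquivNat.symm_apply_apply i
    rw [this]
    cases i with
    | ofNat n =>
      have : Equiv.intEquivNat (Int.ofNat n) = 2 * n := rfl
      rw [this]; simp
    | negSucc n =>
      have : Equiv.intEquivNat (Int.negSucc n) = 2 * n + 1 := rfl
      rw [this]; simp

theorem Primrec.int_neg : Primrec (fun i : ℤ => -i) := by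
  refine Primrec.ofNat_iff.2 (Primrec.of_eq (f := fun n : ℕ => Int.subNatNat
    (if n % 2 = 0 then 0 else n / 2 + 1) (if n % 2 = 0 then n / 2 else 0)) ?_ ?_)
  · have h₁ : PrimrecPred fun n : ℕ => n % 2 = 0 := Primrec.eq.comp
      (Primrec.nat_mod.comp Primrec.id (Primrec.const 2)) (Primrec.const 0)
    have h₂ : Primrec fun n : ℕ => n / 2 := Primrec.nat_div.comp Primrec.id (Primrec.const 2)
    exact Primrec.int_subNatNat.comp (Primrec.ite h₁ (Primrec.const 0) (Primrec.succ.comp h₂))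
      (Primrec.ite h₁ h₂ (Primrec.const 0))
  · intro n
    obtain ⟨i, rfl⟩ := Equiv.intEquivNat.surjective n
    have : Denumerable.ofNat ℤ (Equiv.intEquivNat i) = i := Equiv.intEquivNat.symm_apply_apply i
    rw [this]
    cases i with
    | ofNat n =>
      have : Equiv.intEquivNat (Int.ofNat n) = 2 * n := rfl
      rw [this, Int.subNatNat_eq_coe]; simp
    | negSucc n =>
      have : Equiv.intEquivNat (Int.negSucc n) = 2 * n + 1 := rfl
      rw [this, Int.subNatNat_eq_coe, if_neg (by omega), if_neg (by omega), Int.neg_negSucc]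
      push_cast
      omega

/-- The gcd is found by bounded search for the greatest common divisor up to `m + n`, a bound that
remains valid when one argument is 0; for `m = n = 0` the search returns 0, as it should. -/
theorem Primrec.nat_gcd : Primrec₂ Nat.gcd := by
  have hdvd : ∀ {f g : (ℕ × ℕ) × ℕ → ℕ}, Primrec f → Primrec g →
      PrimrecPred fun p => g p % f p = 0 := fun hf hg =>
    Primrec.eq.comp (Primrec.nat_mod.comp hg hf) (Primrec.const 0)
  have h : PrimrecRel fun (p : ℕ × ℕ) (k : ℕ) => p.1 % k = 0 ∧ p.2 % k = 0 :=
    (hdvd Primrec.snd (Primrec.fst.comp Primrec.fst)).and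
      (hdvd Primrec.snd (Primrec.snd.comp Primrec.fst))
  refine (Primrec.nat_findGreatest (f := fun p : ℕ × ℕ => p.1 + p.2)
    (Primrec.nat_add.comp Primrec.fst Primrec.snd) h).of_eq ?_
  rintro ⟨m, n⟩
  simp only [← Nat.dvd_iff_mod_eq_zero]
  rcases Nat.eq_zero_or_pos (m + n) with h0 | h0
  · have hm : m = 0 := by omega
    have hn : n = 0 := by omega
    subst hm hn
    rfl
  · refine le_antisymm (Nat.le_of_dvd (Nat.gcd_pos_iff.2 (by omega)) ?_) ?_
    · have := Nat.findGreatest_spec (P := fun k => k ∣ m ∧ k ∣ n) (n := m + n) (m := 1) h0 (by simp)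
      exact Nat.dvd_gcd this.1 this.2
    · refine Nat.le_findGreatest ?_ ⟨Nat.gcd_dvd_left m n, Nat.gcd_dvd_right m n⟩
      rcases Nat.eq_zero_or_pos m with hm | hm
      · subst hm; simp
      · exact (Nat.gcd_le_left n hm).trans (Nat.le_add_right m n)

/-- Codes record fractions in lowest terms, so a computed quotient has to be reduced. Of the
truncated differences a - b and b - a one vanishes, so their sum is |a - b|; dividing both, and the
denominator, by its gcd with the denominator gives the reduced fraction. -/
theorem RatPrimrec.num_den {α : Type*} [Primcodable α] {f : α → ℚ} (hf : RatPrimrec f) :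
    Primrec fun x => ((f x).num, (f x).den) := by
  obtain ⟨a, b, d, ha, hb, hd, hf⟩ := hf
  have hab := Primrec.nat_sub.comp ha hb
  have hba := Primrec.nat_sub.comp hb ha
  have hg := Primrec.nat_gcd.comp (Primrec.nat_add.comp hab hba) hd
  refine ((Primrec.int_subNatNat.comp (Primrec.nat_div.comp hab hg)
    (Primrec.nat_div.comp hba hg)).pair (Primrec.nat_div.comp hd hg)).of_eq fun x => ?_
  obtain ⟨hx, hfx⟩ := hf x
  set g := Nat.gcd (a x - b x + (b x - a x)) (d x) with hgdef
  have hgpos : 0 < g := Nat.gcd_pos_of_pos_right _ (Nat.pos_of_ne_zero hx)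
  have hgd : g ∣ d x := Nat.gcd_dvd_right _ _
  have hgs : g ∣ a x - b x + (b x - a x) := Nat.gcd_dvd_left _ _
  have hcop := Nat.coprime_div_gcd_div_gcd (m := a x - b x + (b x - a x)) (n := d x) hgpos
  rw [← hgdef] at hcop
  have h1 : g ∣ a x - b x := by
    rcases le_total (a x) (b x) with h | h
    · simp [Nat.sub_eq_zero_of_le h]
    · rwa [Nat.sub_eq_zero_of_le h, add_zero] at hgs
  have h2 : g ∣ b x - a x := by
    rcases le_total (a x) (b x) with h | h
    · rwa [Nat.sub_eq_zero_of_le h, zero_add] at hgs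
    · simp [Nat.sub_eq_zero_of_le h]
  have hgq : (g : ℚ) ≠ 0 := by exact_mod_cast hgpos.ne'
  have hdq : (d x : ℚ) ≠ 0 := by exact_mod_cast hx
  have hab' : ((a x - b x : ℕ) : ℚ) - (b x - a x : ℕ) = a x - b x := by
    have : ((a x - b x : ℕ) : ℤ) - (b x - a x : ℕ) = a x - b x := by omega
    exact_mod_cast this
  obtain ⟨u, hu⟩ := h1
  obtain ⟨v, hv⟩ := h2
  obtain ⟨w, hw⟩ := hgd
  have huv : u = 0 ∨ v = 0 := by
    by_contra! h
    have := Nat.mul_pos hgpos (Nat.pos_of_ne_zero h.1)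
    have := Nat.mul_pos hgpos (Nat.pos_of_ne_zero h.2)
    omega
  rw [hu, hv, hw, ← mul_add, Nat.mul_div_cancel_left _ hgpos, Nat.mul_div_cancel_left _ hgpos]
    at hcop
  rw [hu, hv] at hab'
  simp only [hu, hv, hw, Nat.mul_div_cancel_left _ hgpos]
  have hw0 : w ≠ 0 := by rintro rfl; exact hx hw
  have hwq : (w : ℚ) ≠ 0 := by exact_mod_cast hw0
  have hval : f x = ((Int.subNatNat u v : ℤ) : ℚ) / ((w : ℕ) : ℤ) := by
    rw [hfx, ← hab', hw, Int.subNatNat_eq_coe]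
    push_cast
    field_simp
  have hpos : (0 : ℤ) < (w : ℤ) := by exact_mod_cast Nat.pos_of_ne_zero hw0
  have hc : Nat.Coprime (Int.subNatNat u v).natAbs (w : ℤ).natAbs := by
    rw [Int.natAbs_natCast]
    convert hcop using 1
    rw [Int.subNatNat_eq_coe]
    rcases huv with rfl | rfl <;> simp
  rw [hval]
  have e1 := Rat.num_div_eq_of_coprime hpos hc
  have e2 := Rat.den_div_eq_of_coprime hpos hc
  rw [e1]
  rw [Int.natCast_inj.1 e2]

/-- A number that is not a genuine code may decode to a denominator 0. Taking the truncated
predecessor and then the successor replaces 0 by 1 and leaves positive denominators unchanged. -/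
theorem ratPrimrec_div : RatPrimrec fun a : ℤ × ℕ => (a.1 : ℚ) / (a.2 - 1 + 1 : ℕ) := by
  refine ⟨fun a => a.1.toNat, fun a => (-a.1).toNat, fun a => a.2 - 1 + 1,
    Primrec.int_toNat.comp Primrec.fst, Primrec.int_toNat.comp (Primrec.int_neg.comp Primrec.fst),
    Primrec.succ.comp (Primrec.nat_sub.comp Primrec.snd (Primrec.const 1)),
    fun x => ⟨Nat.succ_ne_zero _, ?_⟩⟩
  have : (x.1.toNat : ℤ) - (-x.1).toNat = x.1 := by omega
  have : (x.1.toNat : ℚ) - (-x.1).toNat = x.1 := by exact_mod_cast this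
  simp only [this]


/-! ### Computations with elementary vectors and matrices -/

/-- The product of complex numbers, on pairs of rational numbers. -/
def cmul (a b : ℚ × ℚ) : ℚ × ℚ := (a.1 * b.1 - a.2 * b.2, a.1 * b.2 + a.2 * b.1)

/-- Complex conjugation, on pairs of rational numbers. -/
def cconj (a : ℚ × ℚ) : ℚ × ℚ := (a.1, -a.2)

theorem toComplex_cmul (a b : ℚ × ℚ) : toComplex (cmul a b) = toComplex a * toComplex b := by
  apply Complex.ext <;> simp [toComplex, cmul]

theorem toComplex_cconj (a : ℚ × ℚ) : toComplex (cconj a) = star (toComplex a) := by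
  apply Complex.ext <;> simp [toComplex, cconj]

theorem toComplex_sum {ι : Type*} (s : Finset ι) (f : ι → ℚ × ℚ) :
    toComplex (∑ i ∈ s, f i) = ∑ i ∈ s, toComplex (f i) := by
  apply Complex.ext <;> simp [toComplex, Prod.fst_sum, Prod.snd_sum]

theorem toComplex_injective : Function.Injective toComplex := by
  rintro ⟨a, b⟩ ⟨a', b'⟩ h
  simpa [toComplex] using h

/-- A function with values in the complex rational numbers whose real and imaginary part are
`RatPrimrec`. -/
def CRatPrimrec {α : Type*} [Primcodable α] (f : α → ℚ × ℚ) : Prop :=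
  RatPrimrec (fun x => (f x).1) ∧ RatPrimrec (fun x => (f x).2)

namespace CRatPrimrec

variable {α β : Type*} [Primcodable α] [Primcodable β] {f g : α → ℚ × ℚ}

theorem comp {f : β → ℚ × ℚ} (hf : CRatPrimrec f) {h : α → β} (hh : Primrec h) :
    CRatPrimrec fun x => f (h x) :=
  ⟨hf.1.comp hh, hf.2.comp hh⟩

theorem const (q : ℚ × ℚ) : CRatPrimrec fun _ : α => q :=
  ⟨RatPrimrec.const _, RatPrimrec.const _⟩

theorem mul (hf : CRatPrimrec f) (hg : CRatPrimrec g) : CRatPrimrec fun x => cmul (f x) (g x) :=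
  ⟨(hf.1.mul hg.1).sub (hf.2.mul hg.2), (hf.1.mul hg.2).add (hf.2.mul hg.1)⟩

theorem conj (hf : CRatPrimrec f) : CRatPrimrec fun x => cconj (f x) :=
  ⟨hf.1, hf.2.neg⟩

theorem sum_range {f : α × ℕ → ℚ × ℚ} (hf : CRatPrimrec f) {D : α → ℕ} (hD : Primrec D) :
    CRatPrimrec fun x => ∑ k ∈ Finset.range (D x), f (x, k) := by
  constructor
  · simpa only [Prod.fst_sum] using hf.1.sum_range hD
  · simpa only [Prod.snd_sum] using hf.2.sum_range hD

theorem fractions (hf : CRatPrimrec f) : Primrec fun x => fractions (f x) :=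
  hf.1.num_den.pair hf.2.num_den

end CRatPrimrec

/-- The complex rational number with the given numerators and denominators. -/
def ofFractions (a : (ℤ × ℕ) × (ℤ × ℕ)) : ℚ × ℚ :=
  ((a.1.1 : ℚ) / (a.1.2 - 1 + 1 : ℕ), (a.2.1 : ℚ) / (a.2.2 - 1 + 1 : ℕ))

theorem ofFractions_fractions (a : ℚ × ℚ) : ofFractions (fractions a) = a := by
  have h (q : ℚ) : (q.num : ℚ) / (q.den - 1 + 1 : ℕ) = q := by
    rw [Nat.sub_add_cancel q.den_pos, Rat.num_div_den]
  exact Prod.ext (h a.1) (h a.2)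

theorem cRatPrimrec_ofFractions : CRatPrimrec ofFractions :=
  ⟨ratPrimrec_div.comp Primrec.fst, ratPrimrec_div.comp Primrec.snd⟩

/-- The list of numerators and denominators of the vector with code `x`. -/
def vecList (x : ℕ) : List ((ℤ × ℕ) × (ℤ × ℕ)) := (Encodable.decode x).getD []

/-- The list of numerators and denominators of the matrix with code `x`. -/
def matList (x : ℕ) : List (List ((ℤ × ℕ) × (ℤ × ℕ))) := (Encodable.decode x).getD []

theorem vecList_vecCode {d : ℕ} (v : Fin d → ℚ × ℚ) :
    vecList (vecCode v) = List.ofFn fun i => fractions (v i) := by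
  simp [vecList, vecCode]

theorem matList_matCode {d : ℕ} (M : EMatrix d) :
    matList (matCode M) = List.ofFn fun i => List.ofFn fun j => fractions (M i j) := by
  simp [matList, matCode]

theorem primrec_vecList : Primrec vecList :=
  Primrec.option_getD.comp Primrec.decode (Primrec.const [])

theorem primrec_matList : Primrec matList :=
  Primrec.option_getD.comp Primrec.decode (Primrec.const [])

/-- The entries of the vector with code `x`. -/
def vecEntry (x i : ℕ) : ℚ × ℚ := ofFractions ((vecList x).getD i ((0, 0), (0, 0)))

/-- The entries of the matrix with code `x`. -/
def matEntry (x i j : ℕ) : ℚ × ℚ :=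
  ofFractions (((matList x).getD i []).getD j ((0, 0), (0, 0)))

theorem cRatPrimrec_vecEntry : CRatPrimrec fun p : ℕ × ℕ => vecEntry p.1 p.2 :=
  cRatPrimrec_ofFractions.comp
    ((Primrec.list_getD _).comp (primrec_vecList.comp Primrec.fst) Primrec.snd)

theorem cRatPrimrec_matEntry : CRatPrimrec fun p : ℕ × ℕ × ℕ => matEntry p.1 p.2.1 p.2.2 :=
  cRatPrimrec_ofFractions.comp ((Primrec.list_getD _).comp
    ((Primrec.list_getD _).comp (primrec_matList.comp Primrec.fst)
      (Primrec.fst.comp Primrec.snd)) (Primrec.snd.comp Primrec.snd))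

theorem vecEntry_vecCode {d : ℕ} (v : Fin d → ℚ × ℚ) (i : Fin d) :
    vecEntry (vecCode v) i = v i := by
  simp [vecEntry, vecList_vecCode, ofFractions_fractions]

theorem matEntry_matCode {d : ℕ} (M : EMatrix d) (i j : Fin d) :
    matEntry (matCode M) i j = M i j := by
  simp [matEntry, matList_matCode, ofFractions_fractions]

attribute [irreducible] vecEntry matEntry

/-- The dimension of the matrix whose code is the first item of the auxiliary data. -/
def auxDim (z : List ℕ) : ℕ := (matList (z.getD 0 0)).length

theorem auxDim_matCode {d : ℕ} (M : EMatrix d) (l : List ℕ) : auxDim (matCode M :: l) = d := by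
  simp [auxDim, matList_matCode]

theorem primrec_auxDim : Primrec auxDim :=
  Primrec.list_length.comp (primrec_matList.comp
    ((Primrec.list_getD 0).comp Primrec.id (Primrec.const 0)))

theorem map_range_eq_ofFn {α : Type*} {n : ℕ} {f : ℕ → α} {g : Fin n → α}
    (h : ∀ i : Fin n, f i = g i) :
    (List.range n).map f = List.ofFn g := by
  refine List.ext_getElem (by simp) fun i h₁ h₂ => ?_
  simp at h₁
  simpa using h ⟨i, h₁⟩

/-- The matrix-vector product, on elementary matrices and vectors. -/
def EMatrix.apply {d : ℕ} (B : EMatrix d) (v : Fin d → ℚ × ℚ) : Fin d → ℚ × ℚ :=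
  fun i => ∑ k, cmul (B i k) (v k)

/-- The matrix `K • (B ⊗ 1)ᴴ * N * (B ⊗ 1)`, on elementary matrices. -/
def EMatrix.conjTensor {d : ℕ} (K : ℚ) (B : EMatrix d) (N : EMatrix (d * d)) : EMatrix (d * d) :=
  fun i j => ∑ k : Fin d, ∑ l : Fin d, cmul (K, 0) (cmul (cconj (B k i.divNat))
    (cmul (N (finProdFinEquiv (k, i.modNat)) (finProdFinEquiv (l, j.modNat))) (B l j.divNat)))

/-- The code of the product of a matrix and a vector; here `b` maps the auxiliary data and a
position to the entry of the matrix at this position. -/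
def applyCode (b : List ℕ → ℕ → ℕ → ℚ × ℚ) (z : List ℕ) (x : ℕ) : ℕ :=
  Encodable.encode ((List.range (auxDim z)).map fun i =>
    fractions (∑ k ∈ Finset.range (auxDim z), cmul (b z i k) (vecEntry x k)))

/-- A term of the sum that defines an entry of `K • (B ⊗ 1)ᴴ * N * (B ⊗ 1)`, where `x` is the code
of `N`, and `b` maps the auxiliary data and a position to the entry of `B` at this position. -/
def conjTensorTerm (b : List ℕ → ℕ → ℕ → ℚ × ℚ) (K : ℚ) (z : List ℕ) (x i j k l : ℕ) : ℚ × ℚ :=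
  cmul (K, 0) (cmul (cconj (b z k (i / auxDim z)))
    (cmul (matEntry x (i % auxDim z + auxDim z * k) (j % auxDim z + auxDim z * l))
      (b z l (j / auxDim z))))

/-- The code of the matrix `K • (B ⊗ 1)ᴴ * N * (B ⊗ 1)`, where `x` is the code of `N`. -/
def conjTensorCode (b : List ℕ → ℕ → ℕ → ℚ × ℚ) (K : ℚ) (z : List ℕ) (x : ℕ) : ℕ :=
  Encodable.encode ((List.range (auxDim z * auxDim z)).map fun i =>
    (List.range (auxDim z * auxDim z)).map fun j =>
      fractions (∑ k ∈ Finset.range (auxDim z), ∑ l ∈ Finset.range (auxDim z),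
        conjTensorTerm b K z x i j k l))

section

variable {b : List ℕ → ℕ → ℕ → ℚ × ℚ}

/-- One machine has to serve all dimensions: the dimension is part of the data, and the sums have
variable length. -/
theorem primrec_applyCode (hb : CRatPrimrec fun p : List ℕ × ℕ × ℕ => b p.1 p.2.1 p.2.2) :
    Primrec₂ (applyCode b) := by
  have hD : Primrec fun p : List ℕ × ℕ => auxDim p.1 := primrec_auxDim.comp Primrec.fst
  suffices h : CRatPrimrec fun q : (List ℕ × ℕ) × ℕ =>
      ∑ k ∈ Finset.range (auxDim q.1.1), cmul (b q.1.1 q.2 k) (vecEntry q.1.2 k) from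
    Primrec.encode.comp (Primrec.list_map (Primrec.list_range.comp hD) h.fractions.to₂)
  refine CRatPrimrec.sum_range (f := fun q : ((List ℕ × ℕ) × ℕ) × ℕ =>
    cmul (b q.1.1.1 q.1.2 q.2) (vecEntry q.1.1.2 q.2)) (.mul ?_ ?_) (hD.comp Primrec.fst)
  · exact hb.comp ((Primrec.fst.comp (Primrec.fst.comp Primrec.fst)).pair
      ((Primrec.snd.comp Primrec.fst).pair Primrec.snd))
  · exact cRatPrimrec_vecEntry.comp ((Primrec.snd.comp (Primrec.fst.comp Primrec.fst)).pair
      Primrec.snd)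

theorem cRatPrimrec_matEntry_comp {α : Type*} [Primcodable α] {x i j : α → ℕ}
    (hx : Primrec x) (hi : Primrec i) (hj : Primrec j) :
    CRatPrimrec fun a => matEntry (x a) (i a) (j a) :=
  cRatPrimrec_matEntry.comp (hx.pair (hi.pair hj))

theorem cRatPrimrec_conjTensorTerm {α : Type*} [Primcodable α]
    (hb : CRatPrimrec fun p : List ℕ × ℕ × ℕ => b p.1 p.2.1 p.2.2) (K : ℚ) {z : α → List ℕ}
    {x i j k l : α → ℕ} (hz : Primrec z) (hx : Primrec x) (hi : Primrec i) (hj : Primrec j)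
    (hk : Primrec k) (hl : Primrec l) :
    CRatPrimrec fun a => conjTensorTerm b K (z a) (x a) (i a) (j a) (k a) (l a) := by
  have hd := primrec_auxDim.comp hz
  have h₁ : CRatPrimrec fun a => b (z a) (k a) (i a / auxDim (z a)) :=
    hb.comp (hz.pair (hk.pair (Primrec.nat_div.comp hi hd)))
  have hr : Primrec fun a => i a % auxDim (z a) + auxDim (z a) * k a :=
    Primrec.nat_add.comp (Primrec.nat_mod.comp hi hd) (Primrec.nat_mul.comp hd hk)
  have hc : Primrec fun a => j a % auxDim (z a) + auxDim (z a) * l a :=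
    Primrec.nat_add.comp (Primrec.nat_mod.comp hj hd) (Primrec.nat_mul.comp hd hl)
  have h₂ : CRatPrimrec fun a => matEntry (x a) (i a % auxDim (z a) + auxDim (z a) * k a)
      (j a % auxDim (z a) + auxDim (z a) * l a) :=
    cRatPrimrec_matEntry_comp hx hr hc
  have h₃ : CRatPrimrec fun a => b (z a) (l a) (j a / auxDim (z a)) :=
    hb.comp (hz.pair (hl.pair (Primrec.nat_div.comp hj hd)))
  exact (CRatPrimrec.const _).mul (h₁.conj.mul (h₂.mul h₃))

theorem primrec_conjTensorCode (hb : CRatPrimrec fun p : List ℕ × ℕ × ℕ => b p.1 p.2.1 p.2.2)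
    (K : ℚ) : Primrec₂ (conjTensorCode b K) := by
  have hD : Primrec fun p : List ℕ × ℕ => auxDim p.1 := primrec_auxDim.comp Primrec.fst
  have hR := Primrec.list_range.comp (Primrec.nat_mul.comp hD hD)
  have h₀ : CRatPrimrec fun q : ((((List ℕ × ℕ) × ℕ) × ℕ) × ℕ) × ℕ =>
      conjTensorTerm b K q.1.1.1.1.1 q.1.1.1.1.2 q.1.1.1.2 q.1.1.2 q.1.2 q.2 := by
    have f₁ := Primrec.fst (α := (((List ℕ × ℕ) × ℕ) × ℕ) × ℕ) (β := ℕ)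
    have f₂ := Primrec.fst.comp f₁
    have f₃ := Primrec.fst.comp f₂
    have f₄ := Primrec.fst.comp f₃
    exact cRatPrimrec_conjTensorTerm hb K (Primrec.fst.comp f₄) (Primrec.snd.comp f₄)
      (Primrec.snd.comp f₃) (Primrec.snd.comp f₂) (Primrec.snd.comp f₁) Primrec.snd
  have hD₂ : Primrec fun q : ((List ℕ × ℕ) × ℕ) × ℕ => auxDim q.1.1.1 :=
    hD.comp (Primrec.fst.comp Primrec.fst)
  have h₁ := (h₀.sum_range (hD₂.comp Primrec.fst)).sum_range hD₂
  exact Primrec.encode.comp (Primrec.list_map hR (Primrec.to₂ (Primrec.list_map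
    (hR.comp Primrec.fst) h₁.fractions.to₂)))

variable {d : ℕ} {A B : EMatrix d} {l : List ℕ}

/-- The tail `l` is left free because probabilities are conditioned on `A` and `n`, whereas lower
computing programs are given `A` only. -/
theorem applyCode_vecCode (hB : ∀ i j : Fin d, b (matCode A :: l) i j = B i j)
    (v : Fin d → ℚ × ℚ) : applyCode b (matCode A :: l) (vecCode v) = vecCode (B.apply v) := by
  simp only [applyCode, auxDim_matCode]
  rw [vecCode.eq_def (B.apply v)]
  congr 1
  refine map_range_eq_ofFn fun i => ?_
  rw [Finset.sum_range]
  simp [EMatrix.apply, hB, vecEntry_vecCode]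

theorem conjTensorCode_matCode (hB : ∀ i j : Fin d, b (matCode A :: l) i j = B i j) (K : ℚ)
    (N : EMatrix (d * d)) :
    conjTensorCode b K (matCode A :: l) (matCode N) = matCode (B.conjTensor K N) := by
  simp only [conjTensorCode, conjTensorTerm, auxDim_matCode]
  rw [matCode.eq_def (B.conjTensor K N)]
  congr 1
  refine map_range_eq_ofFn fun i => map_range_eq_ofFn fun j => ?_
  congr 1
  simp only [Finset.sum_range, EMatrix.conjTensor]
  refine Finset.sum_congr rfl fun k _ => Finset.sum_congr rfl fun l _ => ?_
  rw [← matEntry_matCode N, ← hB, ← hB]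
  rfl

end

theorem EMatrix.val_mulVec {d : ℕ} (B : EMatrix d) (v : Fin d → ℚ × ℚ) (i : Fin d) :
    toComplex (B.apply v i) = B.val.mulVec (fun j => toComplex (v j)) i := by
  simp [EMatrix.apply, Matrix.mulVec, dotProduct, toComplex_sum, toComplex_cmul, EMatrix.val]

theorem EMatrix.val_conjTensor {d : ℕ} (K : ℚ) (B : EMatrix d) (N : EMatrix (d * d)) :
    (B.conjTensor K N).val =
      (K : ℂ) • ((tensor B.val 1).conjTranspose * N.val * tensor B.val 1) := by
  ext i j
  have hK : toComplex (K, 0) = K := by simp [toComplex, Complex.ext_iff]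
  simp only [EMatrix.val, EMatrix.conjTensor, Matrix.map_apply, toComplex_sum, toComplex_cmul,
    toComplex_cconj, hK, Matrix.smul_apply, Matrix.mul_apply, smul_eq_mul, tensor,
    ← finProdFinEquiv.sum_comp, Fintype.sum_prod_type, Matrix.conjTranspose_apply,
    Matrix.reindex_apply, Matrix.submatrix_apply, Equiv.symm_apply_apply, Matrix.kroneckerMap_apply,
    Matrix.one_apply]
  simp [Finset.mul_sum, Finset.sum_mul]
  rw [Finset.sum_comm]
  refine Finset.sum_congr rfl fun k _ => Finset.sum_congr rfl fun l _ => ?_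
  simp [apply_ite (starRingEnd ℂ), ite_mul, mul_ite, mul_assoc]


/-! ### Positive semidefinite matrices and tensor products -/

section

open scoped MatrixOrder

variable {d : ℕ}

/-- Series of matrices can then be compared term by term in the Loewner order. -/
theorem Matrix.orderClosedTopology : OrderClosedTopology (Matrix (Fin d) (Fin d) ℂ) where
  isClosed_le' := Machine.isClosed_posSemidef.preimage
    (continuous_snd.sub continuous_fst : Continuous
      fun p : Matrix (Fin d) (Fin d) ℂ × Matrix (Fin d) (Fin d) ℂ => p.2 - p.1)

attribute [local instance] Matrix.orderClosedTopology

theorem Matrix.PosSemidef.exists_eq_conjTranspose_mul {M : Matrix (Fin d) (Fin d) ℂ}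
    (h : M.PosSemidef) : ∃ X : Matrix (Fin d) (Fin d) ℂ, M = X.conjTranspose * X :=
  CStarAlgebra.nonneg_iff_eq_star_mul_self.1 h.nonneg

/-- With M = X*X, cyclicity of the trace gives Tr MN = Tr XNX*, and XNX* is positive semidefinite.
-/
theorem Matrix.PosSemidef.trace_mul_nonneg {M N : Matrix (Fin d) (Fin d) ℂ}
    (hM : M.PosSemidef) (hN : N.PosSemidef) : 0 ≤ (M * N).trace.re := by
  obtain ⟨X, rfl⟩ := hM.exists_eq_conjTranspose_mul
  rw [Matrix.mul_assoc, Matrix.trace_mul_comm]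
  exact (Complex.le_def.1 (hN.mul_mul_conjTranspose_same X).trace_nonneg).1

theorem Matrix.PosSemidef.trace_mul_le {M N P : Matrix (Fin d) (Fin d) ℂ}
    (hM : M.PosSemidef) (h : N ≤ P) : (M * N).trace.re ≤ (M * P).trace.re := by
  have := hM.trace_mul_nonneg (Matrix.le_iff.1 h)
  rw [Matrix.mul_sub, Matrix.trace_sub, Complex.sub_re] at this
  linarith

/-- The entries of X*X are inner products of columns of X. Each is at most half the sum of two
squared column norms, and each squared column norm is at most the trace. A bound on traces thus
becomes the bound on entries that summability needs. -/
theorem Matrix.PosSemidef.norm_le_trace {M : Matrix (Fin d) (Fin d) ℂ} (h : M.PosSemidef)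
    (i j : Fin d) : ‖M i j‖ ≤ M.trace.re := by
  obtain ⟨X, rfl⟩ := h.exists_eq_conjTranspose_mul
  have hd : ∀ i, ((X.conjTranspose * X) i i).re = ∑ k, ‖X k i‖ ^ 2 := by
    intro i
    simp [Matrix.mul_apply, ← Complex.normSq_eq_conj_mul_self, Complex.normSq_eq_norm_sq]
    norm_cast
  have ht : ∀ i, ∑ k, ‖X k i‖ ^ 2 ≤ (X.conjTranspose * X).trace.re := by
    intro i
    rw [Matrix.trace, Complex.re_sum]
    simp only [Matrix.diag_apply, hd]
    exact Finset.single_le_sum (f := fun i => ∑ k, ‖X k i‖ ^ 2)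
      (fun i _ => Finset.sum_nonneg fun _ _ => by positivity) (Finset.mem_univ i)
  calc ‖(X.conjTranspose * X) i j‖ ≤ ∑ k, ‖X k i‖ * ‖X k j‖ := by
        rw [Matrix.mul_apply]
        refine (norm_sum_le _ _).trans (le_of_eq ?_)
        simp
    _ ≤ ∑ k, (‖X k i‖ ^ 2 + ‖X k j‖ ^ 2) / 2 := Finset.sum_le_sum fun k _ => by
        nlinarith [sq_nonneg (‖X k i‖ - ‖X k j‖)]
    _ ≤ _ := by
        rw [← Finset.sum_div, Finset.sum_add_distrib]
        linarith [ht i, ht j]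

theorem tensor_mul_tensor (M N P Q : Matrix (Fin d) (Fin d) ℂ) :
    tensor M N * tensor P Q = tensor (M * P) (N * Q) := by
  simp only [tensor, Matrix.reindex_apply, Matrix.submatrix_mul_equiv, Matrix.mul_kronecker_mul]

theorem conjTranspose_tensor (M N : Matrix (Fin d) (Fin d) ℂ) :
    (tensor M N).conjTranspose = tensor M.conjTranspose N.conjTranspose := by
  simp only [tensor, Matrix.reindex_apply, Matrix.conjTranspose_submatrix,
    Matrix.conjTranspose_kronecker]

theorem tensor_one_one : tensor (1 : Matrix (Fin d) (Fin d) ℂ) 1 = 1 := by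
  simp [tensor]

theorem tensor_sub_left (M N P : Matrix (Fin d) (Fin d) ℂ) :
    tensor (M - N) P = tensor M P - tensor N P := by
  ext; simp [tensor, sub_mul]

theorem tensor_sub_right (M N P : Matrix (Fin d) (Fin d) ℂ) :
    tensor P (M - N) = tensor P M - tensor P N := by
  ext; simp [tensor, mul_sub]

theorem tensor_smul_left (c : ℂ) (M N : Matrix (Fin d) (Fin d) ℂ) :
    tensor (c • M) N = c • tensor M N := by
  ext; simp [tensor, mul_assoc]

theorem tensor_smul_right (c : ℂ) (M N : Matrix (Fin d) (Fin d) ℂ) :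
    tensor M (c • N) = c • tensor M N := by
  ext; simp [tensor, mul_left_comm]

theorem Matrix.PosSemidef.tensor {M N : Matrix (Fin d) (Fin d) ℂ} (hM : M.PosSemidef)
    (hN : N.PosSemidef) : (tensor M N).PosSemidef :=
  (hM.kronecker hN).submatrix _

theorem tensor_le_tensor_left {M N P : Matrix (Fin d) (Fin d) ℂ} (h : M ≤ N)
    (hP : P.PosSemidef) : tensor M P ≤ tensor N P := by
  rw [Matrix.le_iff, ← tensor_sub_left]
  exact (Matrix.le_iff.1 h).tensor hP

theorem tensor_le_tensor_right {M N P : Matrix (Fin d) (Fin d) ℂ} (h : M ≤ N)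
    (hP : P.PosSemidef) : tensor P M ≤ tensor P N := by
  rw [Matrix.le_iff, ← tensor_sub_right]
  exact hP.tensor (Matrix.le_iff.1 h)

/-- The map `N ↦ K • (B ⊗ 1)ᴴ * N * (B ⊗ 1)`. -/
def conjTensor (K : ℂ) (B : Matrix (Fin d) (Fin d) ℂ) :
    Matrix (Fin (d * d)) (Fin (d * d)) ℂ →ₗ[ℂ] Matrix (Fin (d * d)) (Fin (d * d)) ℂ :=
  K • (LinearMap.mulRight ℂ (tensor B 1) ∘ₗ LinearMap.mulLeft ℂ (tensor B 1).conjTranspose)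

theorem conjTensor_apply (K : ℂ) (B : Matrix (Fin d) (Fin d) ℂ)
    (N : Matrix (Fin (d * d)) (Fin (d * d)) ℂ) :
    conjTensor K B N = K • ((tensor B 1).conjTranspose * N * tensor B 1) := rfl

/-- Only the first tensor factor is changed, so product tests remain products. -/
theorem conjTensor_tensor (K : ℂ) (B E F : Matrix (Fin d) (Fin d) ℂ) :
    conjTensor K B (tensor E F) = tensor (K • (B.conjTranspose * E * B)) F := by
  rw [conjTensor_apply, conjTranspose_tensor, tensor_mul_tensor, tensor_mul_tensor,
    tensor_smul_left, Matrix.conjTranspose_one, one_mul, mul_one]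

theorem Matrix.PosSemidef.conjTensor {K : ℂ} (hK : 0 ≤ K) (B : Matrix (Fin d) (Fin d) ℂ)
    {N : Matrix (Fin (d * d)) (Fin (d * d)) ℂ} (hN : N.PosSemidef) :
    (conjTensor K B N).PosSemidef :=
  (hN.conjTranspose_mul_mul_same _).smul hK

/-- By cyclicity of the trace, conjugating the test amounts to conjugating the state. -/
theorem trace_conjTensor_mul_tensor (K : ℂ) (B σ ρ : Matrix (Fin d) (Fin d) ℂ)
    (N : Matrix (Fin (d * d)) (Fin (d * d)) ℂ) :
    (conjTensor K B N * tensor σ ρ).trace =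
      K * (N * tensor (B * σ * B.conjTranspose) ρ).trace := by
  rw [conjTensor_apply, Matrix.smul_mul, Matrix.trace_smul, smul_eq_mul, Matrix.mul_assoc,
    Matrix.mul_assoc, Matrix.trace_mul_comm, Matrix.mul_assoc, conjTranspose_tensor,
    tensor_mul_tensor, tensor_mul_tensor, Matrix.conjTranspose_one, one_mul, mul_one]

/-- Conjugation by B ⊗ 1 is undone by the adjoint. Injectivity ensures that no test is counted twice
when the two series are compared. -/
theorem conjTensor_injective {K : ℂ} (hK : K ≠ 0) {B : Matrix (Fin d) (Fin d) ℂ}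
    (hB : B * B.conjTranspose = 1) : Function.Injective (conjTensor K B) := by
  have hS : tensor B 1 * (tensor B 1).conjTranspose = 1 := by
    rw [conjTranspose_tensor, tensor_mul_tensor, hB, Matrix.conjTranspose_one, one_mul,
      tensor_one_one]
  intro M N h
  rw [conjTensor_apply, conjTensor_apply] at h
  have h := smul_right_injective _ hK h
  have h := congrArg (fun X => tensor B 1 * X * (tensor B 1).conjTranspose) h
  simp only [Matrix.mul_assoc, hS, mul_one] at h
  simpa only [← Matrix.mul_assoc, hS, one_mul] using h

/-- A series of matrices with bounded entries and summable weights converges. -/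
theorem summable_toReal_smul {ι : Type*} {w : ι → ℝ≥0∞} (hw : ∑' i, w i ≠ ∞)
    {X : ι → Matrix (Fin d) (Fin d) ℂ} {C : ℝ} (hX : ∀ i a b, ‖X i a b‖ ≤ C) :
    Summable fun i => (w i).toReal • X i := by
  refine Pi.summable.2 fun a => Pi.summable.2 fun b => ?_
  refine Summable.of_norm_bounded ((ENNReal.summable_toReal hw).mul_right C) fun i => ?_
  simp only [Matrix.smul_apply, norm_smul, Real.norm_eq_abs, abs_of_nonneg ENNReal.toReal_nonneg]
  exact mul_le_mul_of_nonneg_left (hX i a b) ENNReal.toReal_nonneg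

end

/-! ### The universal matrix -/

namespace EState

variable {n : ℕ}

/-- The vector of complex numbers denoted by an elementary state. -/
def vec (φ : EState n) : Fin (2 ^ n) → ℂ := fun i => toComplex (φ.1 i)

theorem proj_eq (φ : EState n) : φ.proj = Matrix.vecMulVec φ.vec (star φ.vec) := rfl

theorem posSemidef_proj (φ : EState n) : φ.proj.PosSemidef :=
  Matrix.posSemidef_vecMulVec_self_star _

theorem trace_proj (φ : EState n) : φ.proj.trace = 1 := by
  have : φ.proj.trace = ((∑ i, ‖toComplex (φ.1 i)‖ ^ 2 : ℝ) : ℂ) := by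
    simp [Matrix.trace, proj, Complex.mul_conj, Complex.normSq_eq_norm_sq]
  rw [this, φ.2, Complex.ofReal_one]

/-- The elementary state of the standard basis. -/
def basis (i : Fin (2 ^ n)) : EState n :=
  ⟨Pi.single i (1, 0), by
    have h (j : Fin (2 ^ n)) : ‖toComplex ((Pi.single i (1, 0) : Fin (2 ^ n) → ℚ × ℚ) j)‖ ^ 2 =
        if j = i then 1 else 0 := by
      by_cases hj : j = i
      · subst hj
        have : toComplex (1, 0) = 1 := by simp [toComplex, Complex.ext_iff]
        simp [this]
      · have : toComplex 0 = 0 := by simp [toComplex, Complex.ext_iff]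
        simp [hj, this]
    simp [h]⟩

theorem proj_basis (i : Fin (2 ^ n)) : (basis i).proj = Matrix.single i i 1 := by
  have h (j : Fin (2 ^ n)) : (basis i).vec j = if j = i then 1 else 0 := by
    by_cases hj : j = i
    · subst hj
      simp [vec, basis, toComplex, Complex.ext_iff]
    · simp [vec, basis, hj, toComplex, Complex.ext_iff]
  ext a b
  rw [proj_eq, Matrix.vecMulVec_apply, Pi.star_apply, h, h, Matrix.single_apply]
  by_cases ha : a = i <;> by_cases hb : b = i <;> simp [ha, hb, eq_comm (a := i)]

theorem basis_injective : Function.Injective (basis : Fin (2 ^ n) → EState n) := by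
  intro i j h
  have := congrFun (congrArg Subtype.val h) i
  by_contra hij
  simp [basis, hij] at this

theorem sum_norm_sq_mulVec {d : ℕ} {B : Matrix (Fin d) (Fin d) ℂ} (hB : B.conjTranspose * B = 1)
    (v : Fin d → ℂ) : ∑ i, ‖B.mulVec v i‖ ^ 2 = ∑ i, ‖v i‖ ^ 2 := by
  have h (w : Fin d → ℂ) : ((∑ i, ‖w i‖ ^ 2 : ℝ) : ℂ) = star w ⬝ᵥ w := by
    simp [dotProduct, ← Complex.normSq_eq_conj_mul_self, Complex.normSq_eq_norm_sq]
  have : star (B.mulVec v) ⬝ᵥ B.mulVec v = star v ⬝ᵥ v := by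
    rw [Matrix.star_mulVec, ← Matrix.dotProduct_mulVec, Matrix.mulVec_mulVec, hB, Matrix.one_mulVec]
  rw [← h, ← h] at this
  exact_mod_cast this

/-- The action of an elementary unitary matrix on elementary states. -/
def map (B : EMatrix (2 ^ n)) (hB : B.val.conjTranspose * B.val = 1) (φ : EState n) : EState n :=
  ⟨B.apply φ.1, by
    simp only [EMatrix.val_mulVec]
    rw [sum_norm_sq_mulVec hB, φ.2]⟩

variable {B : EMatrix (2 ^ n)} (hB : B.val.conjTranspose * B.val = 1)

theorem vec_map (φ : EState n) : (φ.map B hB).vec = B.val.mulVec φ.vec :=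
  funext fun i => B.val_mulVec φ.1 i

theorem proj_map (φ : EState n) : (φ.map B hB).proj = B.val * φ.proj * B.val.conjTranspose := by
  rw [proj_eq, proj_eq, vec_map, Matrix.mul_vecMulVec, Matrix.vecMulVec_mul, Matrix.star_mulVec]

theorem map_injective : Function.Injective (EState.map B hB) := by
  intro φ ψ h
  have h := congrArg vec h
  rw [vec_map, vec_map] at h
  have h := congrArg B.val.conjTranspose.mulVec h
  simp only [Matrix.mulVec_mulVec, hB, Matrix.one_mulVec] at h
  exact Subtype.ext (funext fun i => toComplex_injective (congrFun h i))

end EState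

namespace Machine

open scoped MatrixOrder
attribute [local instance] Matrix.orderClosedTopology

variable (U : Machine) (z : List ℕ) (n : ℕ)

/-- The weights add up to at most 1, and the entries of a projector are bounded by its trace 1. -/
theorem summable_universalTerm : Summable (U.universalTerm z n) := by
  refine summable_toReal_smul (C := 1) ?_ fun φ a b => ?_
  · refine ((ENNReal.tsum_comp_le_tsum_of_injective (f := fun φ : EState n => vecCode φ.1) ?_
      fun x => U.prob x (z ++ [n])).trans (U.tsum_prob_le_one _)).trans_lt
        ENNReal.one_lt_top |>.ne
    exact vecCode_injective.comp Subtype.val_injective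
  · simpa [φ.trace_proj] using φ.posSemidef_proj.norm_le_trace a b

theorem universalTerm_nonneg (φ : EState n) : 0 ≤ U.universalTerm z n φ := by
  rw [Matrix.nonneg_iff_posSemidef]
  exact φ.posSemidef_proj.smul ENNReal.toReal_nonneg

theorem posSemidef_universalMatrix : (U.universalMatrix z n).PosSemidef :=
  Matrix.nonneg_iff_posSemidef.1 (tsum_nonneg fun φ => U.universalTerm_nonneg z n φ)

variable {U}

/-- The universal matrix is positive definite. -/
theorem Universal.exists_smul_one_le (hU : U.Universal) :
    ∃ c : ℝ, 0 < c ∧ (c : ℂ) • (1 : Matrix (Fin (2 ^ n)) (Fin (2 ^ n)) ℂ) ≤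
      U.universalMatrix z n := by
  -- The constant is the least weight of a basis state. The basis projectors add up to the identity,
  -- and all other terms of the universal matrix are nonnegative.
  obtain ⟨i₀, hi₀⟩ := Finite.exists_min fun i : Fin (2 ^ n) =>
    (U.prob (vecCode (EState.basis i).1) (z ++ [n])).toReal
  refine ⟨(U.prob (vecCode (EState.basis i₀).1) (z ++ [n])).toReal,
    ENNReal.toReal_pos (hU.prob_ne_zero _ _) (U.prob_ne_top _ _), ?_⟩
  set c := (U.prob (vecCode (EState.basis i₀).1) (z ++ [n])).toReal
  have h1 : (c : ℂ) • (1 : Matrix (Fin (2 ^ n)) (Fin (2 ^ n)) ℂ) =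
      ∑' i : Fin (2 ^ n), c • (EState.basis i).proj := by
    rw [tsum_fintype, ← Finset.smul_sum]
    simp only [EState.proj_basis, Matrix.sum_single_one]
    rfl
  rw [h1]
  refine Summable.tsum_le_tsum_of_inj EState.basis EState.basis_injective
    (fun φ _ => U.universalTerm_nonneg z n φ) (fun i => ?_) (Summable.of_finite)
    (U.summable_universalTerm z n)
  rw [Matrix.le_iff, universalTerm, ← sub_smul]
  exact (EState.posSemidef_proj _).smul (sub_nonneg.2 (hi₀ i))

/-- If the probability of the image of a state under a unitary matrix is at least the probability
of the state, up to a constant factor, then the universal matrix dominates its conjugate. -/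
theorem conj_universalMatrix_le {B : EMatrix (2 ^ n)} (hB : B.val.conjTranspose * B.val = 1)
    {k : ℕ} (h : ∀ φ : EState n, U.prob (vecCode φ.1) (z ++ [n]) ≤
      2 ^ k * U.prob (vecCode (φ.map B hB).1) (z ++ [n])) :
    B.val * U.universalMatrix z n * B.val.conjTranspose ≤ (2 ^ k : ℂ) • U.universalMatrix z n := by
  have hs := U.summable_universalTerm z n
  have h₁ : HasSum (fun φ => B.val * U.universalTerm z n φ * B.val.conjTranspose)
      (B.val * U.universalMatrix z n * B.val.conjTranspose) :=
    (hs.hasSum.mul_left _).mul_right _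
  have h₂ : HasSum (fun φ => (2 ^ k : ℂ) • U.universalTerm z n φ)
      ((2 ^ k : ℂ) • U.universalMatrix z n) :=
    hs.hasSum.const_smul _
  rw [← h₁.tsum_eq, ← h₂.tsum_eq]
  -- The term of φ on the left is compared with the term of Bφ on the right; both are multiples of
  -- the projector of Bφ.
  refine Summable.tsum_le_tsum_of_inj (EState.map B hB) (EState.map_injective hB)
    (fun φ _ => ?_) (fun φ => ?_) h₁.summable h₂.summable
  · rw [Matrix.nonneg_iff_posSemidef]
    exact (Matrix.nonneg_iff_posSemidef.1 (U.universalTerm_nonneg z n φ)).smul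
      (by positivity : (0 : ℂ) ≤ 2 ^ k)
  · have hk : (U.prob (vecCode φ.1) (z ++ [n])).toReal ≤
        2 ^ k * (U.prob (vecCode (φ.map B hB).1) (z ++ [n])).toReal := by
      simpa using ENNReal.toReal_mono (ENNReal.mul_ne_top (by simp) (U.prob_ne_top _ _)) (h φ)
    have h2 : (2 ^ k : ℂ) • U.universalTerm z n (φ.map B hB) =
        (2 ^ k * (U.prob (vecCode (φ.map B hB).1) (z ++ [n])).toReal) • (φ.map B hB).proj := by
      ext i j
      simp [universalTerm, mul_assoc]
    rw [Matrix.le_iff, h2, universalTerm, Matrix.mul_smul, Matrix.smul_mul, ← EState.proj_map hB,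
      ← sub_smul]
    exact (EState.posSemidef_proj _).smul (sub_nonneg.2 hk)

end Machine

namespace Machine

open scoped MatrixOrder
attribute [local instance] Matrix.orderClosedTopology

/-! ### Product tests -/

section

variable (U : Machine) (z : List ℕ) (n : ℕ) {d : ℕ}

/-- Every program lower computes at most one matrix, so that the lower algorithmic probabilities
add up to at most `1`. -/
theorem tsum_lowerProb_le_one (S : Set (Matrix (Fin d) (Fin d) ℂ)) :
    ∑' ν : S, U.lowerProb z n ν.1 ≤ 1 := by
  unfold lowerProb
  rw [← ENNReal.tsum_sigma' (fun a : Σ ν : S, {q : List Bool // U.LowerComputes z q ν.1} =>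
    U.prob (Encodable.encode a.2.1) (z ++ [n]))]
  refine (ENNReal.tsum_comp_le_tsum_of_injective
    (f := fun a : Σ ν : S, {q : List Bool // U.LowerComputes z q ν.1} => Encodable.encode a.2.1) ?_
      fun x => U.prob x (z ++ [n])).trans (U.tsum_prob_le_one _)
  rintro ⟨ν, q, hq⟩ ⟨ν', q', hq'⟩ h
  obtain rfl : q = q' := Encodable.encode_injective h
  obtain rfl : ν = ν' := Subtype.ext (hq.unique hq')
  rfl

theorem lowerProb_ne_top (ν : Matrix (Fin d) (Fin d) ℂ) : U.lowerProb z n ν ≠ ∞ :=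
  ((ENNReal.le_tsum (⟨ν, rfl⟩ : ({ν} : Set (Matrix (Fin d) (Fin d) ℂ)))).trans
    (U.tsum_lowerProb_le_one z n {ν})).trans_lt ENNReal.one_lt_top |>.ne

end

variable {U : Machine} {z : List ℕ} {n : ℕ} {d : ℕ}

theorem posSemidef_of_mem_productTests {C D : Matrix (Fin d) (Fin d) ℂ}
    {ν : Matrix (Fin (d * d)) (Fin (d * d)) ℂ} (h : ν ∈ U.productTests z C D) : ν.PosSemidef := by
  obtain ⟨-, ⟨q, hq⟩, -⟩ := h
  exact hq.posSemidef

/-- From μ ≥ c·1 follows μ ⊗ μ ≥ c²·1, so a test ν satisfies c² Tr ν ≤ Tr ν(μ ⊗ μ) ≤ 1. All tests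
have entries bounded by c^(-2), and their weights are summable. -/
theorem Universal.summable_testTerm (hU : U.Universal) (z : List ℕ) (n : ℕ) :
    Summable (U.testTerm z n (U.universalMatrix z n) (U.universalMatrix z n)) := by
  obtain ⟨c, hc, hcμ⟩ := hU.exists_smul_one_le z n
  have hμ := U.posSemidef_universalMatrix z n
  have h1 : ((c * c : ℝ) : ℂ) • (1 : Matrix (Fin (2 ^ n * 2 ^ n)) (Fin (2 ^ n * 2 ^ n)) ℂ) ≤
      tensor (U.universalMatrix z n) (U.universalMatrix z n) := by
    calc _ = tensor ((c : ℂ) • (1 : Matrix (Fin (2 ^ n)) (Fin (2 ^ n)) ℂ)) ((c : ℂ) • 1) := by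
          rw [tensor_smul_left, tensor_smul_right, tensor_one_one, smul_smul, Complex.ofReal_mul]
      _ ≤ tensor ((c : ℂ) • (1 : Matrix (Fin (2 ^ n)) (Fin (2 ^ n)) ℂ)) (U.universalMatrix z n) :=
          tensor_le_tensor_right hcμ (Matrix.PosSemidef.one.smul
            (by exact_mod_cast hc.le : (0 : ℂ) ≤ c))
      _ ≤ _ := tensor_le_tensor_left hcμ hμ
  refine summable_toReal_smul (C := (c * c)⁻¹)
    ((U.tsum_lowerProb_le_one z n _).trans_lt ENNReal.one_lt_top).ne fun ν a b => ?_
  have hν := posSemidef_of_mem_productTests ν.2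
  refine (hν.norm_le_trace a b).trans ?_
  have h2 := (hν.trace_mul_le h1).trans ν.2.2.2
  rw [Matrix.mul_smul, mul_one, Matrix.trace_smul, smul_eq_mul, Complex.re_ofReal_mul] at h2
  rw [← one_div, le_div_iff₀ (by positivity)]
  linarith

/-- The functional M ↦ Re Tr MX is additive and continuous, so it passes through the series. -/
theorem Universal.hasSum_trace_aggregatedTest_mul (hU : U.Universal) (z : List ℕ) (n : ℕ)
    (X : Matrix (Fin (2 ^ n * 2 ^ n)) (Fin (2 ^ n * 2 ^ n)) ℂ) :
    HasSum (fun ν : U.productTests z (U.universalMatrix z n) (U.universalMatrix z n) =>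
        (U.lowerProb z n ν.1).toReal * (ν.1 * X).trace.re)
      (U.aggregatedTest z n (U.universalMatrix z n) (U.universalMatrix z n) * X).trace.re := by
  have h := (hU.summable_testTerm z n).hasSum
  have hc : Continuous fun M : Matrix (Fin (2 ^ n * 2 ^ n)) (Fin (2 ^ n * 2 ^ n)) ℂ =>
      (M * X).trace.re := by fun_prop
  let f : Matrix (Fin (2 ^ n * 2 ^ n)) (Fin (2 ^ n * 2 ^ n)) ℂ →+ ℝ :=
    { toFun := fun M => (M * X).trace.re
      map_zero' := by simp
      map_add' := fun M N => by simp [Matrix.add_mul] }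
  have h' := h.map f hc
  refine h'.congr_fun fun ν => ?_
  simp [f, testTerm]

/-! ### Conservation of information under a computable unitary. -/

/-- The trace of the aggregated test increases by at most a constant factor under the action of
a unitary matrix whose entries can be computed from the auxiliary data. -/
theorem Universal.exists_trace_aggregatedTest_le (hU : U.Universal)
    {b : List ℕ → ℕ → ℕ → ℚ × ℚ} (hb : CRatPrimrec fun p : List ℕ × ℕ × ℕ => b p.1 p.2.1 p.2.2) :
    ∃ m : ℕ, ∀ (n : ℕ) (A B : EMatrix (2 ^ n)),
      (∀ (l : List ℕ) (i j : Fin (2 ^ n)), b (matCode A :: l) i j = B i j) →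
      B.val ∈ Matrix.unitaryGroup (Fin (2 ^ n)) ℂ →
      ∀ σ ρ : Matrix (Fin (2 ^ n)) (Fin (2 ^ n)) ℂ, σ.PosSemidef → ρ.PosSemidef →
        (U.aggregatedTest [matCode A] n (U.universalMatrix [matCode A] n)
          (U.universalMatrix [matCode A] n) *
            tensor (B.val * σ * B.val.conjTranspose) ρ).trace.re ≤
        2 ^ m * (U.aggregatedTest [matCode A] n (U.universalMatrix [matCode A] n)
          (U.universalMatrix [matCode A] n) * tensor σ ρ).trace.re := by
  obtain ⟨k, hk⟩ := hU.exists_prob_le (primrec_applyCode hb).to_comp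
  -- This factor compensates the loss in BμB* ≤ 2^k μ, so that the transformed test is again a test.
  -- It is rational, so elementary matrices stay elementary.
  set K : ℚ := (2 ^ k)⁻¹ with hK
  obtain ⟨r, hr⟩ := hU.exists_prefix (primrec_conjTensorCode hb K).to_comp
  obtain ⟨m, hm⟩ := hU.exists_prob_append_le r
  refine ⟨m + k, fun n A B hbB hB σ ρ hσ hρ => ?_⟩
  have hB₁ : B.val.conjTranspose * B.val = 1 := Matrix.mem_unitaryGroup_iff'.1 hB
  have hB₂ : B.val * B.val.conjTranspose = 1 := Matrix.mem_unitaryGroup_iff.1 hB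
  set z := [matCode A] with hz
  set μ := U.universalMatrix z n with hμ
  have hμ₀ : μ.PosSemidef := U.posSemidef_universalMatrix z n
  have hμB : B.val * μ * B.val.conjTranspose ≤ (2 ^ k : ℂ) • μ := by
    refine conj_universalMatrix_le z n hB₁ fun φ => ?_
    have := hk (z ++ [n]) (vecCode φ.1)
    rwa [hz, List.singleton_append, applyCode_vecCode (hbB [n])] at this
  have hKpos : (0 : ℂ) ≤ (K : ℂ) := by rw [hK]; push_cast; positivity
  have hKC : (K : ℂ) * 2 ^ k = 1 := by rw [hK]; push_cast; exact inv_mul_cancel₀ (by simp)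
  have hK0 : (K : ℂ) ≠ 0 := left_ne_zero_of_mul_eq_one hKC
  let T := conjTensor (K : ℂ) B.val
  have htr : ∀ ν σ' ρ', (ν * tensor (B.val * σ' * B.val.conjTranspose) ρ').trace.re =
      2 ^ k * (T ν * tensor σ' ρ').trace.re := by
    intro ν σ' ρ'
    have := trace_conjTensor_mul_tensor (K : ℂ) B.val σ' ρ' ν
    have h2 : (ν * tensor (B.val * σ' * B.val.conjTranspose) ρ').trace =
        ((2 ^ k : ℝ) : ℂ) * (T ν * tensor σ' ρ').trace := by
      rw [this, ← mul_assoc]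
      push_cast
      rw [mul_comm _ (K : ℂ), hKC, one_mul]
    rw [h2, Complex.re_ofReal_mul]
  have hlow : ∀ {ν q}, U.LowerComputes z q ν → U.LowerComputes z (r ++ q) (T ν) := by
    intro ν q hq
    exact hq.map (hr z q) T (fun M hM => hM.conjTensor hKpos B.val) (B.conjTensor K)
      (fun M => B.val_conjTensor K M) fun M => conjTensorCode_matCode (hbB []) K M
  -- By `htr`, 2^k Tr Tν(μ ⊗ μ) = Tr ν(BμB* ⊗ μ) ≤ 2^k Tr ν(μ ⊗ μ), and the factor 2^k cancels.
  have hmem : ∀ ν ∈ U.productTests z μ μ, T ν ∈ U.productTests z μ μ := by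
    intro ν hν
    have hν₀ := posSemidef_of_mem_productTests hν
    obtain ⟨⟨E, F, rfl⟩, ⟨q, hq⟩, ht⟩ := hν
    refine ⟨⟨_, F, conjTensor_tensor _ _ E F⟩, ⟨_, hlow hq⟩, ?_⟩
    have h1 := hν₀.trace_mul_le (tensor_le_tensor_left hμB hμ₀)
    rw [htr, tensor_smul_left, Matrix.mul_smul, Matrix.trace_smul, smul_eq_mul,
      show (2 ^ k : ℂ) = ((2 ^ k : ℝ) : ℂ) by push_cast; rfl, Complex.re_ofReal_mul] at h1
    exact (le_of_mul_le_mul_left h1 (by positivity)).trans ht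
  -- Prefixing `r` injects the programs for ν into those for T ν; each loses at most the factor 2^m.
  have hprob : ∀ ν, (U.lowerProb z n ν).toReal ≤ 2 ^ m * (U.lowerProb z n (T ν)).toReal := by
    intro ν
    have : U.lowerProb z n ν ≤ 2 ^ m * U.lowerProb z n (T ν) := by
      unfold lowerProb
      let f : {q // U.LowerComputes z q ν} → {q // U.LowerComputes z q (T ν)} :=
        fun q => ⟨r ++ q.1, hlow q.2⟩
      have hf : Function.Injective f := by
        rintro ⟨p, hp⟩ ⟨q, hq⟩ hpq
        simpa [f] using hpq
      refine (ENNReal.tsum_le_tsum fun q : {q // U.LowerComputes z q ν} =>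
        hm (z ++ [n]) q.1).trans ?_
      rw [ENNReal.tsum_mul_left]
      gcongr
      exact ENNReal.tsum_comp_le_tsum_of_injective hf
        fun q : {q // U.LowerComputes z q (T ν)} => U.prob (Encodable.encode q.1) (z ++ [n])
    simpa using ENNReal.toReal_mono (ENNReal.mul_ne_top (by simp) (U.lowerProb_ne_top _ _ _)) this
  have h₁ := hU.hasSum_trace_aggregatedTest_mul z n (tensor (B.val * σ * B.val.conjTranspose) ρ)
  have h₂ := (hU.hasSum_trace_aggregatedTest_mul z n (tensor σ ρ)).mul_left (2 ^ (m + k))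
  rw [← h₁.tsum_eq, ← h₂.tsum_eq]
  have hnn : ∀ ν ∈ U.productTests z μ μ, 0 ≤ (ν * tensor σ ρ).trace.re := fun ν hν =>
    (posSemidef_of_mem_productTests hν).trace_mul_nonneg (hσ.tensor hρ)
  -- The term of ν is bounded by the term of T ν: 2^k comes from undoing the normalization, 2^m from
  -- the weights. Tests outside the range of T only add nonnegative terms.
  refine Summable.tsum_le_tsum_of_inj (fun ν => ⟨T ν.1, hmem _ ν.2⟩) (fun ν ν' h => ?_)
    (fun ν _ => ?_) (fun ν => ?_) h₁.summable h₂.summable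
  · exact Subtype.ext (conjTensor_injective hK0 hB₂ (congrArg Subtype.val h))
  · have := hnn ν.1 ν.2
    positivity
  · rw [htr]
    have h3 := hnn _ (hmem _ ν.2)
    calc _ ≤ 2 ^ m * (U.lowerProb z n (T ν.1)).toReal *
          (2 ^ k * (T ν.1 * tensor σ ρ).trace.re) := by gcongr; exact hprob _
      _ = _ := by ring

/-- Logarithms turn the factor 2^m into the summand m. `ENNReal.ofReal` and the extended logarithm
are monotone, so vanishing traces, with value -∞, need no separate treatment. -/
theorem mutualInfo_le_of_trace_le {n m : ℕ} {σ τ ρ : Matrix (Fin (2 ^ n)) (Fin (2 ^ n)) ℂ}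
    (h : (U.aggregatedTest z n (U.universalMatrix z n) (U.universalMatrix z n) *
        tensor σ ρ).trace.re ≤
      2 ^ m * (U.aggregatedTest z n (U.universalMatrix z n) (U.universalMatrix z n) *
        tensor τ ρ).trace.re) {c : ℝ} (hc : m ≤ c) :
    U.mutualInfo z n σ ρ ≤ U.mutualInfo z n τ ρ + (c : EReal) := by
  unfold mutualInfo
  have hlog : (0 : ℝ) < Real.log 2 := Real.log_pos one_lt_two
  have h1 := ENNReal.log_le_log (ENNReal.ofReal_le_ofReal h)
  rw [ENNReal.ofReal_mul (by positivity), ENNReal.log_mul_add] at h1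
  have h2 := EReal.div_le_div_right_of_nonneg
    (by exact_mod_cast hlog.le : (0 : EReal) ≤ (Real.log 2 : ℝ)) h1
  rw [EReal.add_div_of_nonneg_right (by exact_mod_cast hlog.le), add_comm] at h2
  refine h2.trans (add_le_add le_rfl ?_)
  rw [ENNReal.log_ofReal, if_neg (not_le.2 (by positivity)), Real.log_pow, ← EReal.coe_div,
    mul_div_assoc, div_self hlog.ne', mul_one]
  exact_mod_cast hc

end Machine

end

theorem theorem5 (U : Machine) (hU : U.Universal) :
    (∀ (z : List ℕ) (n : ℕ), Summable (U.universalTerm z n) ∧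
      Summable (U.testTerm z n (U.universalMatrix z n) (U.universalMatrix z n))) ∧
    ∃ c : ℝ, ∀ (n : ℕ) (A : EMatrix (2 ^ n)), A.val ∈ Matrix.unitaryGroup (Fin (2 ^ n)) ℂ →
      ∀ σ ρ : Matrix (Fin (2 ^ n)) (Fin (2 ^ n)) ℂ, IsSemiDensity σ → IsSemiDensity ρ →
        U.mutualInfo [matCode A] n (A.val * σ * A.val.conjTranspose) ρ
            ≤ U.mutualInfo [matCode A] n σ ρ + (c : EReal) ∧
        U.mutualInfo [matCode A] n σ ρ
            ≤ U.mutualInfo [matCode A] n (A.val * σ * A.val.conjTranspose) ρ + (c : EReal) := by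
  refine ⟨fun z n => ⟨U.summable_universalTerm z n, hU.summable_testTerm z n⟩, ?_⟩
  have hentry : CRatPrimrec fun p : List ℕ × ℕ × ℕ => matEntry (p.1.getD 0 0) p.2.1 p.2.2 :=
    cRatPrimrec_matEntry_comp ((Primrec.list_getD 0).comp Primrec.fst (Primrec.const 0))
      (Primrec.fst.comp Primrec.snd) (Primrec.snd.comp Primrec.snd)
  have hentry' : CRatPrimrec fun p : List ℕ × ℕ × ℕ =>
      cconj (matEntry (p.1.getD 0 0) p.2.2 p.2.1) :=
    (cRatPrimrec_matEntry_comp ((Primrec.list_getD 0).comp Primrec.fst (Primrec.const 0))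
      (Primrec.snd.comp Primrec.snd) (Primrec.fst.comp Primrec.snd)).conj
  obtain ⟨m, hm⟩ := hU.exists_trace_aggregatedTest_le
    (b := fun z i j => matEntry (z.getD 0 0) i j) hentry
  obtain ⟨m', hm'⟩ := hU.exists_trace_aggregatedTest_le
    (b := fun z i j => cconj (matEntry (z.getD 0 0) j i)) hentry'
  refine ⟨max m m', fun n A hA σ ρ hσ hρ => ⟨?_, ?_⟩⟩
  · exact Machine.mutualInfo_le_of_trace_le
      (hm n A A (fun l i j => matEntry_matCode A i j) hA σ ρ hσ.1 hρ.1) (le_max_left _ _)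
  -- The adjoint of `A` is again computable from the code of `A`, and it carries AσA* back to σ.
  · let B : EMatrix (2 ^ n) := fun i j => cconj (A j i)
    have hBA : B.val = A.val.conjTranspose := by
      ext i j
      exact toComplex_cconj _
    have hB : B.val ∈ Matrix.unitaryGroup (Fin (2 ^ n)) ℂ := by
      rw [hBA]; exact Unitary.star_mem hA
    have h := hm' n A B (fun l i j => congrArg cconj (matEntry_matCode A j i)) hB
      (A.val * σ * A.val.conjTranspose) ρ (hσ.1.mul_mul_conjTranspose_same _) hρ.1
    have hA' : A.val.conjTranspose * A.val = 1 := Matrix.mem_unitaryGroup_iff'.1 hA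
    have hσ' : B.val * (A.val * σ * A.val.conjTranspose) * B.val.conjTranspose = σ := by
      rw [hBA, Matrix.conjTranspose_conjTranspose]
      calc _ = (A.val.conjTranspose * A.val) * σ * (A.val.conjTranspose * A.val) := by
            simp only [Matrix.mul_assoc]
        _ = σ := by rw [hA', one_mul, mul_one]
    rw [hσ'] at h
    exact Machine.mutualInfo_le_of_trace_le h (le_max_right _ _)
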